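/- **Setting.** Let $V$ be a finite-dimensional real vector space, $\mathcal H$ a finite-dimensional complex Hilbert space, $\iota$ a real-linear map from $V$ to the real vector space $i\mathfrak u(\mathcal H)$ of Hermitian operators on $\mathcal H$, and $W\in i\mathfrak u(\mathcal H)$. Such a tuple $(V,\mathcal H,\iota,W)$ is a *generalized functional theory*. It is *abelian* if $[\iota(v),\iota(v')]=0$ for all $v,v'\in V$. Let $\mathcal P$ be the set of pure states $|\Psi\rangle\langle\Psi|$, $\|\Psi\|=1$, regarded as linear functionals $A\mapsto\langle\Psi,A\Psi\rangle$ on $i\mathfrak u(\mathcal H)$, and let $\iota^*:(i\mathfrak u(\mathcal H))^*\to V^*$ be the dual map of $\iota$ (the density map). The *pure functional* is $$\mathcal F_p(\rho)=\min\{\langle\Gamma,W\rangle : \Gamma\in\mathcal P,\ \iota^*(\Gamma)=\rho\},\qquad \rho\in\iota^*(\mathcal P).$$ A *minimizer at $\rho$* is a unit vector $\Phi\in\mathcal H$ such that $|\Phi\rangle\langle\Phi|$ attains this minimum. For $\alpha\in V^*$ put $\mathcal H_\alpha=\{\Psi\in\mathcal H : \iota(v)\Psi=\langle\alpha,v\rangle\Psi\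 \ \forall v\in V\}$, let $\Pi_\alpha$ be the orthogonal projection onto $\mathcal H_\alpha$, and let $\Omega=\{\alpha\in V^*:\mathcal H_\alpha\ne0\}$ be the (finite) set of *weights*. For a facet $F$ (a nonempty face of codimension one) of the polytope $\mathrm{conv}(\Omega)$ put $\Omega_F=\Omega\cap F$ and $\mathcal H_F=\bigoplus_{\omega\in\Omega_F}\mathcal H_\omega$, with orthogonal projection $\Pi_F:\mathcal H\to\mathcal H_F$. The *facet functional theory* is $(V,\mathcal H_F,\iota_F,\Pi_FW\Pi_F^\dagger)$ with $\iota_F(v)=\Pi_F\,\iota(v)\,\Pi_F^\dagger$. The *facet density map* is the restriction of $\iota_F^*$ to the set $\mathcal P_F$ of pure states on $\mathcal H_F$, regarded as a smooth map $\mathcal P_F\to\mathrm{aff}(\iota_F^*(\mathcal P_F))$. A point $\rho$ is a *regular value* of it if its derivative is surjective at every $\Gamma\in\mathcal P_F$ with $\iota_F^*(\Gamma)=\rho$. **Theorem (boundary force formula for abelian functional theories).** Let $(V,\mathcal H,\iota,W)$ be an abelian functional theory, $F$ a facet of $\mathrm{conv}(\Omega)$, and $\rho_*\in F$. 1. $\rho_*$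 is a regular value of the facet density map if and only if $\rho_*$ does not lie in the convex hull of (at most) $\dim F$ weights. 2. Suppose that $\rho_*$ is a regular value of the facet density map. Let $\eta\in V^*$ be a vector parallel to $\mathrm{aff}(\Omega)$ that is inward-pointing at $\rho_*$, i.e. $\rho_*+\epsilon\eta\in\mathrm{conv}(\Omega)\setminus F$ for all sufficiently small $\epsilon>0$. Let $S\in V$ be perpendicular to $F$ (that is, $\langle\alpha,S\rangle=0$ for every $\alpha$ in the translation space of $\mathrm{aff}(F)$) with $\langle\eta,S\rangle=1$, and let $\gamma\in\mathrm{aff}(F)$. Then $\langle\omega,S\rangle-\langle\gamma,S\rangle>0$ for every $\omega\in\Omega\setminus\Omega_F$. Moreover, among the minimizers $\Phi$ at $\rho_*$ there is one for which $$-2\left[\sum_{\omega\in\Omega\setminus\Omega_F}\frac{\|\Pi_\omega W\Phi\|^2}{\langle\omega,S\rangle-\langle\gamma,S\rangle}\right]^{1/2}$$ is smallest. For every such $\Phi$ the following limit exists and $$\lim_{\epsilon\to0^+}\frac{\mathcal F_p(\rho_*+\epsilon\eta)-\mathcal F_p(\rho_*)}{\sqrt\epsilon}=-2\left[\sum_{\omega\in\Omega\setminus\Omega_F}\frac{\|\Pi_\omega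 W\Phi\|^2}{\langle\omega,S\rangle-\langle\gamma,S\rangle}\right]^{1/2}.$$ -/

import Mathlib

open Filter Topology
open scoped InnerProductSpace

/-- `Herm H` is the real vector space `i𝔲(H)` of Hermitian operators on a finite-dimensional complex
Hilbert space `H`. -/
abbrev Herm (H : Type*) [NormedAddCommGroup H] [InnerProductSpace ℂ H] [FiniteDimensional ℂ H] :
    Type _ :=
  selfAdjoint (H →ₗ[ℂ] H)

section States

variable {H : Type*} [NormedAddCommGroup H] [InnerProductSpace ℂ H] [FiniteDimensional ℂ H]

/-- The operator `|Ψ⟩⟨Ψ|`, regarded as the linear functional `A ↦ Tr(|Ψ⟩⟨Ψ| A) = ⟨Ψ, A Ψ⟩` on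
Hermitian operators. -/
noncomputable def ketBra (Ψ : H) : Module.Dual ℝ (Herm H) where
  toFun A := (⟪Ψ, (A : H →ₗ[ℂ] H) Ψ⟫_ℂ).re
  map_add' A B := by simp
  map_smul' c A := by simp [inner_smul_right_eq_smul]

variable (H) in
/-- The set `𝒫` of pure states. -/
def pureStates : Set (Module.Dual ℝ (Herm H)) :=
  {Γ | ∃ Ψ : H, ‖Ψ‖ = 1 ∧ Γ = ketBra Ψ}

/-- The compression `Π_K A Π_K†` of a Hermitian operator to a subspace `K`, where `Π_K : H → K` is
the orthogonal projection (so that `Π_K†` is the inclusion `K → H`). -/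
noncomputable def compress (K : Submodule ℂ H) : Herm H →ₗ[ℝ] Herm K where
  toFun A := ⟨(K.orthogonalProjectionOnto : H →ₗ[ℂ] K) ∘ₗ (A : H →ₗ[ℂ] H) ∘ₗ K.subtype, by
    have hA : LinearMap.IsSymmetric (A : H →ₗ[ℂ] H) :=
      (LinearMap.isSymmetric_iff_isSelfAdjoint _).2 A.2
    refine (LinearMap.isSymmetric_iff_isSelfAdjoint _).1 fun x y => ?_
    simpa [Submodule.coe_inner] using hA (x : H) (y : H)⟩
  map_add' A B := by ext x; simp
  map_smul' c A := by ext x; simp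

end States

/-- A generalized functional theory `(V, H, ι, W)`: a potential map `ι : V → i𝔲(H)` and an
interaction `W ∈ i𝔲(H)`. -/
structure GeneralizedFunctionalTheory (V H : Type*) [AddCommGroup V] [Module ℝ V]
    [NormedAddCommGroup H] [InnerProductSpace ℂ H] [FiniteDimensional ℂ H] where
  /-- the potential map -/
  ι : V →ₗ[ℝ] Herm H
  /-- the interaction -/
  W : Herm H

namespace GeneralizedFunctionalTheory

variable {V H : Type*} [AddCommGroup V] [Module ℝ V]
  [NormedAddCommGroup H] [InnerProductSpace ℂ H] [FiniteDimensional ℂ H]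
  (T : GeneralizedFunctionalTheory V H)

/-- The theory is abelian if all external potentials commute. -/
def IsAbelian : Prop :=
  ∀ v v' : V, Commute (T.ι v : H →ₗ[ℂ] H) (T.ι v' : H →ₗ[ℂ] H)

/-- The density map `ι* : (i𝔲(H))* → V*`. -/
noncomputable def densityMap : Module.Dual ℝ (Herm H) →ₗ[ℝ] Module.Dual ℝ V :=
  T.ι.dualMap

/-- The pure states with density `ρ`. -/
def pureFiber (ρ : Module.Dual ℝ V) : Set (Module.Dual ℝ (Herm H)) :=
  {Γ | Γ ∈ pureStates H ∧ T.densityMap Γ = ρ}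

/-- The pure (Levy–Lieb) functional `ℱ_p(ρ) = min {⟨Γ, W⟩ | Γ ∈ 𝒫, ι*(Γ) = ρ}`. The infimum is
attained as soon as `ρ` is representable, see `isLeast_pureFunctional`. -/
noncomputable def pureFunctional (ρ : Module.Dual ℝ V) : ℝ :=
  sInf ((fun Γ : Module.Dual ℝ (Herm H) => Γ T.W) '' T.pureFiber ρ)

theorem isLeast_pureFunctional (ρ : Module.Dual ℝ V) (hρ : (T.pureFiber ρ).Nonempty) :
    IsLeast ((fun Γ : Module.Dual ℝ (Herm H) => Γ T.W) '' T.pureFiber ρ)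
      (T.pureFunctional ρ) := by
  have hc : ∀ A : Herm H, Continuous fun Ψ : H => ketBra Ψ A := fun A => by
    have hA : Continuous (A : H →ₗ[ℂ] H) := LinearMap.continuous_of_finiteDimensional _
    exact Complex.continuous_re.comp (continuous_id.inner hA)
  have him : (fun Γ : Module.Dual ℝ (Herm H) => Γ T.W) '' T.pureFiber ρ =
      (fun Ψ : H => ketBra Ψ T.W) ''
        (Metric.sphere (0 : H) 1 ∩ ⋂ v : V, {Ψ : H | ketBra Ψ (T.ι v) = ρ v}) := by
    ext r
    constructor
    · rintro ⟨Γ, ⟨⟨Ψ, hΨ, rfl⟩, h⟩, rfl⟩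
      exact ⟨Ψ, ⟨by simpa using hΨ, Set.mem_iInter.2 fun v => LinearMap.congr_fun h v⟩, rfl⟩
    · rintro ⟨Ψ, ⟨hΨ, h⟩, rfl⟩
      exact ⟨ketBra Ψ, ⟨⟨Ψ, by simpa using hΨ, rfl⟩,
        LinearMap.ext fun v => Set.mem_iInter.1 h v⟩, rfl⟩
  have : ProperSpace H := FiniteDimensional.proper ℂ H
  have hcomp : IsCompact ((fun Γ : Module.Dual ℝ (Herm H) => Γ T.W) '' T.pureFiber ρ) := by
    rw [him]
    exact ((isCompact_sphere _ _).inter_right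
      (isClosed_iInter fun v => isClosed_eq (hc _) continuous_const)).image (hc _)
  exact hcomp.isLeast_sInf (hρ.image _)

/-- The unit vector `Φ` is a minimizer of the constrained search at `ρ`. -/
def IsMinimizer (ρ : Module.Dual ℝ V) (Φ : H) : Prop :=
  ‖Φ‖ = 1 ∧ ketBra Φ ∈ T.pureFiber ρ ∧
    IsMinOn (fun Γ : Module.Dual ℝ (Herm H) => Γ T.W) (T.pureFiber ρ) (ketBra Φ)

/-- The density `ρ` is a regular value of the pure-state density map
`ι*|_𝒫 : 𝒫 → aff(ι*(𝒫))`: at every pure state `|Ψ⟩⟨Ψ|` with density `ρ`, the derivative maps the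
tangent space `T_{|Ψ⟩⟨Ψ|}𝒫 ≅ Ψ^⊥` onto the translation space of `aff(ι*(𝒫))`. -/
def IsRegularValue (ρ : Module.Dual ℝ V) : Prop :=
  ∀ Ψ : H, ‖Ψ‖ = 1 → T.densityMap (ketBra Ψ) = ρ →
    ∀ α ∈ vectorSpan ℝ (T.densityMap '' pureStates H),
      ∃ φ : H, ⟪Ψ, φ⟫_ℂ = 0 ∧
        ∀ v : V, fderiv ℝ (fun Ψ' : H => T.densityMap (ketBra Ψ') v) Ψ φ = α v

/-- The weight space `H_α`. -/
def weightSpace (α : Module.Dual ℝ V) : Submodule ℂ H where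
  carrier := {Ψ | ∀ v : V, (T.ι v : H →ₗ[ℂ] H) Ψ = ((α v : ℝ) : ℂ) • Ψ}
  add_mem' ha hb v := by rw [map_add, ha v, hb v, smul_add]
  zero_mem' v := by simp
  smul_mem' c x hx v := by rw [map_smul, hx v, smul_comm]

/-- The set `Ω` of weights. -/
def weights : Set (Module.Dual ℝ V) :=
  {α | T.weightSpace α ≠ ⊥}

theorem finite_weights : T.weights.Finite := by
  have hex : ∀ α : T.weights, ∃ x ∈ T.weightSpace (α : Module.Dual ℝ V), x ≠ 0 :=
    fun α => (Submodule.ne_bot_iff _).1 α.2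
  choose f hf hf0 using hex
  have hli : LinearIndependent ℂ f := by
    refine linearIndependent_of_ne_zero_of_inner_eq_zero hf0 fun α β hne => ?_
    have hne' : (α : Module.Dual ℝ V) ≠ β := fun h => hne (Subtype.ext h)
    obtain ⟨v, hv⟩ : ∃ v, (α : Module.Dual ℝ V) v ≠ (β : Module.Dual ℝ V) v := by
      by_contra! h
      exact hne' (LinearMap.ext h)
    have hs : LinearMap.IsSymmetric (T.ι v : H →ₗ[ℂ] H) :=
      (LinearMap.isSymmetric_iff_isSelfAdjoint _).2 (T.ι v).2
    have h := hs (f α) (f β)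
    rw [hf α v, hf β v, inner_smul_left, inner_smul_right, Complex.conj_ofReal] at h
    by_contra h0
    exact hv (by exact_mod_cast mul_right_cancel₀ h0 h)
  have : Finite T.weights := hli.finite
  exact Set.toFinite _

/-- The facet functional theory `(V, H_F, ι_F, Π_F W Π_F†)`, where `H_F` is the sum of the weight
spaces of the weights in `Ω_F = Ω ∩ F` and `ι_F(v) = Π_F ι(v) Π_F†`. -/
noncomputable def facetTheory (F : Set (Module.Dual ℝ V)) :
    GeneralizedFunctionalTheory V ↥(⨆ ω ∈ T.weights ∩ F, T.weightSpace ω) where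
  ι := (compress _).comp T.ι
  W := compress _ T.W

/-- The right-hand side
`-2 [∑_{ω ∈ Ω ∖ Ω_F} ‖Π_ω W Φ‖² / (⟨ω, S⟩ - ⟨γ, S⟩)]^{1/2}` of the boundary force formula. -/
noncomputable def boundaryForce (F : Set (Module.Dual ℝ V)) (S : V) (γ : Module.Dual ℝ V)
    (Φ : H) : ℝ :=
  -2 * √(∑ ω ∈ (T.finite_weights.sdiff (t := F)).toFinset,
    ‖(T.weightSpace ω).orthogonalProjectionOnto ((T.W : H →ₗ[ℂ] H) Φ)‖ ^ 2 / (ω S - γ S))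

end GeneralizedFunctionalTheory

section Polytopes

variable {V : Type*} [AddCommGroup V] [Module ℝ V]

/-- `F` is a facet of the convex polytope `P ⊆ V*`: a nonempty face (the set of minimizers over `P`
of some linear functional `ρ ↦ ⟨ρ, v⟩`) of codimension one in `P`. -/
def IsFacet (P F : Set (Module.Dual ℝ V)) : Prop :=
  F.Nonempty ∧ (∃ v : V, F = {ρ | ρ ∈ P ∧ ∀ σ ∈ P, ρ v ≤ σ v}) ∧
    Module.finrank ℝ (vectorSpan ℝ F) + 1 = Module.finrank ℝ (vectorSpan ℝ P)

/-- The vector `η`, parallel to `aff(P)`, is inward-pointing at the point `ρ` of the facet `F` of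
`P`: moving from `ρ` a short way in the direction `η`, one stays in `P` and leaves `F`. -/
def IsInwardPointing (P F : Set (Module.Dual ℝ V)) (ρ η : Module.Dual ℝ V) : Prop :=
  η ∈ vectorSpan ℝ P ∧ ∀ᶠ ε : ℝ in 𝓝[>] 0, ρ + ε • η ∈ P \ F

end Polytopes

/-! The potentials of an abelian theory commute, so `H` is the orthogonal sum of the weight spaces
(`sum_weightProj`), and the density of a unit vector `Ψ` is the average of the weights `ω` with
respect to the probabilities `‖Π_ω Ψ‖²` (`densityMap_ketBra`). In particular a state with density on
the facet `F` only involves weights on `F`.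

The differential of the density map at `Ψ`, on vectors orthogonal to `Ψ`, has as image the
translation space of the affine span of the weights occurring in `Ψ`. So `ρ` is a regular value if
and only if the weights occurring in any state of density `ρ` affinely span `aff(F)`
(`facetTheory_isRegularValue_iff`), and the criterion in terms of convex hulls follows by
Carathéodory's theorem.

For the boundary force put `d_ω = ⟨ω, S⟩ - ⟨γ, S⟩`. This vanishes on `F` and is positive off `F`,
and a state with density `ρ + ε η` satisfies `∑ d_ω ‖Π_ω Ψ‖² = ε`, as one sees by evaluating the
density on `S`. So its component `b` off the facet has size of order `√ε`. If the state is close to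
a state `Φ` of density `ρ`, its energy `⟨Ψ, W Ψ⟩` is the energy inside the facet space, plus the
coupling `2 Re ⟨b, W Φ⟩` of order `√ε`, plus terms negligible against `√ε`. By the Cauchy–Schwarz
inequality the coupling is at least `-2 √ε [∑ ‖Π_ω W Φ‖² / d_ω]^{1/2}`, and equality is attained.

The density inside the facet space thereby gets shifted by an amount of order `ε`. Regularity is
what makes this harmless: each `ω - d_ω η` lies in `aff(F)`, hence is an affine combination of the
weights occurring in `Φ`, and rescaling the corresponding components of a state near `Φ` realizes
the shift by a change of the state of order `ε` (`exists_density_correction`). This yields the upper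
bound `exists_state_energy_le` and the lower bound `exists_le_energy` for states near `Φ`. By
compactness, minimizers at `ρ + ε η` accumulate only at minimizers at `ρ`, so the two bounds
together give the limit (`tendsto_boundaryForce`). -/

namespace GeneralizedFunctionalTheory

variable {V H : Type*} [AddCommGroup V] [Module ℝ V]
  [NormedAddCommGroup H] [InnerProductSpace ℂ H] [FiniteDimensional ℂ H]
  (T : GeneralizedFunctionalTheory V H)

/-! ### Weight decomposition -/

/-- The set of weights as a finite set. -/
noncomputable def weightFinset : Finset (Module.Dual ℝ V) := T.finite_weights.toFinset

@[simp] theorem mem_weightFinset {α : Module.Dual ℝ V} : α ∈ T.weightFinset ↔ α ∈ T.weights := by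
  simp [weightFinset]

theorem coe_weightFinset : (T.weightFinset : Set (Module.Dual ℝ V)) = T.weights := by
  simp [weightFinset]

/-- The orthogonal projection onto the weight space of `α`, as an operator on `H`. -/
noncomputable def weightProj (α : Module.Dual ℝ V) : H →L[ℂ] H := (T.weightSpace α).starProjection

theorem weightProj_mem (α : Module.Dual ℝ V) (x : H) : T.weightProj α x ∈ T.weightSpace α :=
  Submodule.starProjection_apply_mem _ _

theorem norm_weightProj_le (α : Module.Dual ℝ V) (x : H) : ‖T.weightProj α x‖ ≤ ‖x‖ :=
  Submodule.norm_starProjection_apply_le _ _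

theorem isSymmetric_herm (A : Herm H) : LinearMap.IsSymmetric (A : H →ₗ[ℂ] H) :=
  (LinearMap.isSymmetric_iff_isSelfAdjoint _).2 A.2

theorem inner_eq_zero_of_mem_weightSpace {α β : Module.Dual ℝ V} (hne : α ≠ β) {x y : H}
    (hx : x ∈ T.weightSpace α) (hy : y ∈ T.weightSpace β) : ⟪x, y⟫_ℂ = 0 := by
  obtain ⟨v, hv⟩ : ∃ v, α v ≠ β v := by
    by_contra! h
    exact hne (LinearMap.ext h)
  have h := isSymmetric_herm (T.ι v) x y
  rw [hx v, hy v, inner_smul_left, inner_smul_right, Complex.conj_ofReal] at h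
  by_contra h0
  exact hv (by exact_mod_cast mul_right_cancel₀ h0 h)

theorem orthogonalFamily_weightSpace :
    OrthogonalFamily ℂ (fun α => T.weightSpace α) fun α => (T.weightSpace α).subtypeₗᵢ :=
  fun _ _ hne x y => T.inner_eq_zero_of_mem_weightSpace hne x.2 y.2

theorem weightProj_of_mem {α : Module.Dual ℝ V} {x : H} (hx : x ∈ T.weightSpace α) :
    T.weightProj α x = x :=
  Submodule.starProjection_eq_self_iff.2 hx

theorem weightProj_of_mem_of_ne {α β : Module.Dual ℝ V} (hne : α ≠ β) {x : H}
    (hx : x ∈ T.weightSpace α) : T.weightProj β x = 0 :=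
  (Submodule.starProjection_apply_eq_zero_iff _).2
    fun _ hy => T.inner_eq_zero_of_mem_weightSpace hne.symm hy hx

theorem weightSpace_eq_bot {α : Module.Dual ℝ V} (h : α ∉ T.weights) : T.weightSpace α = ⊥ := by
  simpa [weights] using h

theorem mem_weights_of_ne_zero {α : Module.Dual ℝ V} {x : H} (hx : x ∈ T.weightSpace α)
    (h : x ≠ 0) : α ∈ T.weights :=
  (Submodule.ne_bot_iff _).2 ⟨x, hx, h⟩

theorem weightProj_sum (s : Finset (Module.Dual ℝ V)) (y : Module.Dual ℝ V → H)
    (hy : ∀ α, y α ∈ T.weightSpace α) (β : Module.Dual ℝ V) [Decidable (β ∈ s)] :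
    T.weightProj β (∑ α ∈ s, y α) = if β ∈ s then y β else 0 := by
  classical
  rw [map_sum]
  have : ∀ α ∈ s, T.weightProj β (y α) = if β = α then y β else 0 := by
    intro α _
    split_ifs with h
    · subst h; exact T.weightProj_of_mem (hy _)
    · exact T.weightProj_of_mem_of_ne (Ne.symm h) (hy _)
  rw [Finset.sum_congr rfl this, Finset.sum_ite_eq]
  split_ifs <;> rfl

variable {T}

/-- A joint eigenspace of the commuting operators `ι(v)` that contains a nonzero vector is a weight
space, since its eigenvalues are real and linear in `v`. -/
theorem iSup_weightSpace_eq_top (hT : T.IsAbelian) : ⨆ α, T.weightSpace α = ⊤ := by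
  have h := LinearMap.IsSymmetric.iSup_iInf_eq_top_of_commute
    (T := fun v : V => (T.ι v : H →ₗ[ℂ] H)) (fun v => isSymmetric_herm _)
    (fun v v' _ => hT v v')
  rw [eq_top_iff, ← h]
  refine iSup_le fun χ => ?_
  by_cases hbot : (⨅ v, Module.End.eigenspace (T.ι v : H →ₗ[ℂ] H) (χ v)) = ⊥
  · rw [hbot]; exact bot_le
  obtain ⟨x, hx, hx0⟩ := (Submodule.ne_bot_iff _).1 hbot
  have hx' : ∀ v, (T.ι v : H →ₗ[ℂ] H) x = χ v • x := fun v =>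
    Module.End.mem_eigenspace_iff.1 ((Submodule.mem_iInf _).1 hx v)
  have hreal : ∀ v, ((χ v).re : ℂ) = χ v := fun v => by
    have h1 := isSymmetric_herm (T.ι v) x x
    rw [hx', inner_smul_left, inner_smul_right] at h1
    exact Complex.conj_eq_iff_re.1 (mul_right_cancel₀ (inner_self_ne_zero.2 hx0) h1)
  have hadd : ∀ v w, χ (v + w) = χ v + χ w := fun v w => by
    have h1 := hx' (v + w)
    rw [map_add, AddSubgroup.coe_add, LinearMap.add_apply, hx', hx', ← add_smul] at h1
    exact (smul_left_injective ℂ hx0 h1).symm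
  have hsmul : ∀ (c : ℝ) v, χ (c • v) = c * χ v := fun c v => by
    have h1 := hx' (c • v)
    rw [map_smul, selfAdjoint.val_smul, LinearMap.smul_apply, hx',
      ← Complex.coe_smul, smul_smul] at h1
    exact (smul_left_injective ℂ hx0 h1).symm
  let α : Module.Dual ℝ V :=
    { toFun := fun v => (χ v).re
      map_add' := fun v w => by rw [hadd, Complex.add_re]
      map_smul' := fun c v => by rw [hsmul, Complex.re_ofReal_mul]; rfl }
  refine le_trans (b := T.weightSpace α) (fun y hy v => ?_)
    (le_iSup (fun α => T.weightSpace α) α)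
  rw [Module.End.mem_eigenspace_iff.1 ((Submodule.mem_iInf _).1 hy v)]
  change χ v • y = ((χ v).re : ℂ) • y
  rw [hreal]

theorem sum_weightProj (hT : T.IsAbelian) (x : H) : ∑ α ∈ T.weightFinset, T.weightProj α x = x := by
  have hle : (⊤ : Submodule ℂ H) ≤ ⨆ α : T.weightFinset, T.weightSpace α := by
    rw [← iSup_weightSpace_eq_top hT]
    refine iSup_le fun α => ?_
    by_cases h : α ∈ T.weights
    · exact le_iSup (fun α : T.weightFinset => T.weightSpace α) ⟨α, T.mem_weightFinset.2 h⟩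
    · rw [T.weightSpace_eq_bot h]; exact bot_le
  have := (T.orthogonalFamily_weightSpace.comp
    (Subtype.coe_injective (p := fun α => α ∈ T.weightFinset))).sum_projection_of_mem_iSup x
      (hle trivial)
  rw [← Finset.sum_coe_sort]
  exact this

theorem inner_eq_sum (hT : T.IsAbelian) (x y : H) :
    ⟪x, y⟫_ℂ = ∑ α ∈ T.weightFinset, ⟪T.weightProj α x, T.weightProj α y⟫_ℂ := by
  conv_lhs => rw [← sum_weightProj hT y, inner_sum]
  refine Finset.sum_congr rfl fun α _ => ?_
  have h : T.weightProj α (T.weightProj α y) = T.weightProj α y :=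
    T.weightProj_of_mem (T.weightProj_mem _ _)
  rw [← h]
  exact ((T.weightSpace α).inner_starProjection_left_eq_right _ _).symm.trans (by rw [h]; rfl)

theorem norm_sq_eq_sum (hT : T.IsAbelian) (x : H) :
    ‖x‖ ^ 2 = ∑ α ∈ T.weightFinset, ‖T.weightProj α x‖ ^ 2 := by
  have h := inner_eq_sum hT x x
  simp_rw [inner_self_eq_norm_sq_to_K] at h
  exact_mod_cast h

theorem ext_weightProj (hT : T.IsAbelian) {x y : H}
    (h : ∀ α ∈ T.weights, T.weightProj α x = T.weightProj α y) : x = y := by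
  rw [← sum_weightProj hT x, ← sum_weightProj hT y]
  exact Finset.sum_congr rfl fun α hα => h α (T.mem_weightFinset.1 hα)

variable (T) in
theorem ι_weightProj (v : V) (α : Module.Dual ℝ V) (x : H) :
    (T.ι v : H →ₗ[ℂ] H) (T.weightProj α x) = ((α v : ℝ) : ℂ) • T.weightProj α x :=
  T.weightProj_mem α x v

theorem weightProj_ι (hT : T.IsAbelian) (v : V) {α : Module.Dual ℝ V} (hα : α ∈ T.weights) (x : H) :
    T.weightProj α ((T.ι v : H →ₗ[ℂ] H) x) = ((α v : ℝ) : ℂ) • T.weightProj α x := by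
  classical
  conv_lhs => rw [← sum_weightProj hT x, map_sum]
  simp_rw [ι_weightProj]
  rw [T.weightProj_sum _ (fun α => ((α v : ℝ) : ℂ) • T.weightProj α x)
    (fun α => Submodule.smul_mem _ _ (T.weightProj_mem _ _)), if_pos (T.mem_weightFinset.2 hα)]

theorem inner_ι_eq_sum (hT : T.IsAbelian) (v : V) (x y : H) :
    (⟪x, (T.ι v : H →ₗ[ℂ] H) y⟫_ℂ).re =
      ∑ α ∈ T.weightFinset, (⟪T.weightProj α x, T.weightProj α y⟫_ℂ).re * α v := by
  rw [inner_eq_sum hT, Complex.re_sum]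
  refine Finset.sum_congr rfl fun α hα => ?_
  rw [weightProj_ι hT v (T.mem_weightFinset.1 hα), inner_smul_right, Complex.re_ofReal_mul,
    mul_comm]

/-- The density of a vector is the average of the weights with respect to the squared norms of its
weight components. -/
theorem densityMap_ketBra (hT : T.IsAbelian) (x : H) :
    T.densityMap (ketBra x) = ∑ α ∈ T.weightFinset, ‖T.weightProj α x‖ ^ 2 • α := by
  ext v
  rw [LinearMap.sum_apply]
  refine (inner_ι_eq_sum hT v x x).trans (Finset.sum_congr rfl fun α _ => ?_)
  rw [LinearMap.smul_apply, smul_eq_mul, inner_self_eq_norm_sq_to_K]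
  norm_cast

theorem densityMap_ketBra_apply (hT : T.IsAbelian) (x : H) (v : V) :
    T.densityMap (ketBra x) v = ∑ α ∈ T.weightFinset, ‖T.weightProj α x‖ ^ 2 * α v := by
  rw [densityMap_ketBra hT, LinearMap.sum_apply]; rfl

variable (T) in
theorem exists_norm_weightProj_sq_eq (p : Module.Dual ℝ V → ℝ) (hp : ∀ α ∈ T.weights, 0 ≤ p α) :
    ∃ x : H, ∀ α ∈ T.weights, ‖T.weightProj α x‖ ^ 2 = p α := by
  classical
  have hex : ∀ α, ∃ x ∈ T.weightSpace α, α ∈ T.weights → ‖x‖ = 1 := by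
    intro α
    by_cases h : α ∈ T.weights
    · obtain ⟨x, hx, hx0⟩ := (Submodule.ne_bot_iff _).1 h
      exact ⟨((‖x‖⁻¹ : ℝ) : ℂ) • x, Submodule.smul_mem _ _ hx, fun _ => by
        rw [norm_smul, Complex.norm_real, norm_inv, norm_norm,
          inv_mul_cancel₀ (norm_ne_zero_iff.2 hx0)]⟩
    · exact ⟨0, Submodule.zero_mem _, fun h' => absurd h' h⟩
  choose e he he1 using hex
  refine ⟨∑ α ∈ T.weightFinset, ((√(p α) : ℝ) : ℂ) • e α, fun α hα => ?_⟩
  rw [T.weightProj_sum _ (fun α => ((√(p α) : ℝ) : ℂ) • e α)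
    (fun α => Submodule.smul_mem _ _ (he α)), if_pos (T.mem_weightFinset.2 hα), norm_smul,
    he1 α hα, mul_one, Complex.norm_real, Real.norm_eq_abs, sq_abs, Real.sq_sqrt (hp α hα)]

end GeneralizedFunctionalTheory

/-! ### Facets and affine spans -/

section Affine

theorem exists_sum_smul_eq_of_mem_vectorSpan {E : Type*} [AddCommGroup E] [Module ℝ E] {s : Set E}
    {t : Finset E} (hst : s ⊆ t) {x : E} (hx : x ∈ vectorSpan ℝ s) :
    ∃ c : E → ℝ, (∀ y, y ∉ s → c y = 0) ∧ ∑ y ∈ t, c y = 0 ∧ ∑ y ∈ t, c y • y = x := by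
  classical
  rw [vectorSpan_def] at hx
  induction hx using Submodule.span_induction with
  | mem x hx =>
    obtain ⟨a, ha, b, hb, rfl⟩ := Set.mem_vsub.1 hx
    refine ⟨fun y => (if y = a then 1 else 0) - (if y = b then 1 else 0), fun y hy => ?_, ?_, ?_⟩
    · dsimp only
      rw [if_neg (ne_of_mem_of_not_mem ha hy).symm, if_neg (ne_of_mem_of_not_mem hb hy).symm,
        sub_zero]
    · have ha' := Finset.mem_coe.1 (hst ha)
      have hb' := Finset.mem_coe.1 (hst hb)
      simp [ha', hb']
    · have ha' := Finset.mem_coe.1 (hst ha)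
      have hb' := Finset.mem_coe.1 (hst hb)
      simp [sub_smul, ha', hb']
  | zero => exact ⟨0, by simp⟩
  | add x y _ _ hx hy =>
    obtain ⟨c, h1, h2, h3⟩ := hx
    obtain ⟨d, k1, k2, k3⟩ := hy
    refine ⟨c + d, fun y hy => by simp [h1 y hy, k1 y hy], ?_, ?_⟩
    · simp [Finset.sum_add_distrib, h2, k2]
    · simp [add_smul, Finset.sum_add_distrib, h3, k3]
  | smul a x _ hx =>
    obtain ⟨c, h1, h2, h3⟩ := hx
    refine ⟨a • c, fun y hy => by simp [h1 y hy], ?_, ?_⟩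
    · simp [← Finset.mul_sum, h2]
    · simp [mul_smul, ← Finset.smul_sum, h3]

theorem sum_smul_mem_vectorSpan {E : Type*} [AddCommGroup E] [Module ℝ E] {s : Set E}
    {t : Finset E} {c : E → ℝ} (hs : s.Nonempty) (hc : ∀ y, y ∉ s → c y = 0)
    (h0 : ∑ y ∈ t, c y = 0) : ∑ y ∈ t, c y • y ∈ vectorSpan ℝ s := by
  obtain ⟨z, hz⟩ := hs
  have : ∑ y ∈ t, c y • y = ∑ y ∈ t, c y • (y - z) := by
    simp_rw [smul_sub, Finset.sum_sub_distrib, ← Finset.sum_smul, h0, zero_smul, sub_zero]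
  rw [this]
  refine Submodule.sum_mem _ fun y _ => ?_
  by_cases hy : y ∈ s
  · exact Submodule.smul_mem _ _ (vsub_mem_vectorSpan ℝ hy hz)
  · rw [hc y hy, zero_smul]; exact Submodule.zero_mem _

variable {V : Type*} [AddCommGroup V] [Module ℝ V]

theorem apply_eq_zero_of_mem_vectorSpan {F : Set (Module.Dual ℝ V)} {v : V} {c : ℝ}
    (h : ∀ σ ∈ F, σ v = c) {α : Module.Dual ℝ V} (hα : α ∈ vectorSpan ℝ F) : α v = 0 := by
  have : vectorSpan ℝ F ≤ LinearMap.ker (Module.Dual.eval ℝ V v) := by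
    rw [vectorSpan_def, Submodule.span_le]
    rintro _ ⟨a, ha, b, hb, rfl⟩
    simp [h a ha, h b hb]
  simpa using this hα

/-- A facet is cut out of the polytope by a supporting hyperplane. -/
theorem IsFacet.exists_supporting {P F : Set (Module.Dual ℝ V)} (hF : IsFacet P F) :
    ∃ (v : V) (c : ℝ), (∀ σ ∈ P, c ≤ σ v) ∧ ∀ σ, σ ∈ F ↔ σ ∈ P ∧ σ v = c := by
  obtain ⟨⟨τ, hτ⟩, ⟨v, hv⟩, -⟩ := hF
  rw [hv] at hτ
  refine ⟨v, τ v, hτ.2, fun σ => ?_⟩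
  rw [hv]
  exact ⟨fun h => ⟨h.1, le_antisymm (h.2 τ hτ.1) (hτ.2 σ h.1)⟩,
    fun h => ⟨h.1, fun σ' hσ' => h.2.trans_le (hτ.2 σ' hσ')⟩⟩

theorem IsFacet.subset {P F : Set (Module.Dual ℝ V)} (hF : IsFacet P F) : F ⊆ P := by
  obtain ⟨v, c, -, h⟩ := hF.exists_supporting
  exact fun σ hσ => ((h σ).1 hσ).1

/-- A convex combination of points of the polytope that lies on a facet only involves points of
the facet. -/
theorem IsFacet.mem_of_sum_smul_mem {P F : Set (Module.Dual ℝ V)} (hF : IsFacet P F)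
    {t : Finset (Module.Dual ℝ V)} (ht : (t : Set (Module.Dual ℝ V)) ⊆ P)
    {p : Module.Dual ℝ V → ℝ} (hp : ∀ ω ∈ t, 0 ≤ p ω) (h1 : ∑ ω ∈ t, p ω = 1)
    (hσ : ∑ ω ∈ t, p ω • ω ∈ F) {ω : Module.Dual ℝ V} (hω : ω ∈ t) (hne : p ω ≠ 0) : ω ∈ F := by
  obtain ⟨v, c, hv, h⟩ := hF.exists_supporting
  have hc := ((h _).1 hσ).2
  rw [LinearMap.sum_apply] at hc
  have h0 : ∑ ω ∈ t, p ω * (ω v - c) = 0 := by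
    simp_rw [mul_sub, Finset.sum_sub_distrib, ← Finset.sum_mul, h1, one_mul]
    exact sub_eq_zero.2 hc
  have := (Finset.sum_eq_zero_iff_of_nonneg
    fun ω hω => mul_nonneg (hp ω hω) (sub_nonneg.2 (hv ω (ht hω)))).1 h0 ω hω
  exact (h ω).2 ⟨ht hω, sub_eq_zero.1 ((mul_eq_zero.1 this).resolve_left hne)⟩

/-- Since a facet has codimension one, its translation space contains every vector parallel to the
polytope that `S` annihilates. -/
theorem IsFacet.mem_vectorSpan [FiniteDimensional ℝ V] {P F : Set (Module.Dual ℝ V)}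
    (hF : IsFacet P F)
    {η : Module.Dual ℝ V} {S : V} (hη : η ∈ vectorSpan ℝ P) (hS : ∀ α ∈ vectorSpan ℝ F, α S = 0)
    (hηS : η S = 1) {β : Module.Dual ℝ V} (hβ : β ∈ vectorSpan ℝ P) (hβS : β S = 0) :
    β ∈ vectorSpan ℝ F := by
  set K := vectorSpan ℝ P ⊓ LinearMap.ker (Module.Dual.eval ℝ V S) with hK
  have hle : vectorSpan ℝ F ≤ K :=
    le_inf (vectorSpan_mono ℝ hF.subset) fun α hα => by simpa using hS α hα
  have hlt : K < vectorSpan ℝ P := by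
    refine lt_of_le_of_ne inf_le_left fun h => ?_
    have : η ∈ K := h ▸ hη
    have h0 : η S = 0 := by simpa using this.2
    exact one_ne_zero (hηS.symm.trans h0)
  have h1 := Submodule.finrank_lt_finrank_of_lt hlt
  rw [← hF.2.2] at h1
  rw [Submodule.eq_of_le_of_finrank_le hle (Nat.lt_succ_iff.1 h1)]
  exact ⟨hβ, by simpa using hβS⟩

theorem apply_eq_of_mem_affineSpan {F : Set (Module.Dual ℝ V)} {S : V}
    (hS : ∀ α ∈ vectorSpan ℝ F, α S = 0) {ρ γ : Module.Dual ℝ V} (hρ : ρ ∈ F)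
    (hγ : γ ∈ affineSpan ℝ F) : γ S = ρ S := by
  have := hS (γ - ρ) (by
    rw [← direction_affineSpan]
    exact AffineSubspace.vsub_mem_direction hγ (subset_affineSpan ℝ F hρ))
  exact sub_eq_zero.1 this

/-- Subtracting the right multiple of `η` moves every point of the polytope into the affine span of
the facet. -/
theorem IsFacet.sub_smul_sub_mem_vectorSpan [FiniteDimensional ℝ V]
    {P F : Set (Module.Dual ℝ V)} (hF : IsFacet P F)
    {ρ η γ : Module.Dual ℝ V} {S : V} (hρ : ρ ∈ F) (hη : η ∈ vectorSpan ℝ P)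
    (hS : ∀ α ∈ vectorSpan ℝ F, α S = 0) (hηS : η S = 1) (hγ : γ ∈ affineSpan ℝ F)
    {ω : Module.Dual ℝ V} (hω : ω ∈ P) : ω - (ω S - γ S) • η - ρ ∈ vectorSpan ℝ F := by
  refine hF.mem_vectorSpan hη hS hηS ?_ ?_
  · rw [sub_right_comm]
    exact Submodule.sub_mem _ (vsub_mem_vectorSpan ℝ hω (hF.subset hρ))
      (Submodule.smul_mem _ _ hη)
  · simp [hηS, apply_eq_of_mem_affineSpan hS hρ hγ]

theorem IsFacet.apply_sub_apply_pos [FiniteDimensional ℝ V]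
    {P F : Set (Module.Dual ℝ V)} (hF : IsFacet P F)
    {ρ η γ : Module.Dual ℝ V} {S : V} (hρ : ρ ∈ F) (hη : IsInwardPointing P F ρ η)
    (hS : ∀ α ∈ vectorSpan ℝ F, α S = 0) (hηS : η S = 1) (hγ : γ ∈ affineSpan ℝ F)
    {ω : Module.Dual ℝ V} (hω : ω ∈ P) (hωF : ω ∉ F) : 0 < ω S - γ S := by
  obtain ⟨v, c, hv, h⟩ := hF.exists_supporting
  have hpos : ∀ σ ∈ P, σ ∉ F → c < σ v := fun σ h1 h2 =>
    lt_of_le_of_ne (hv σ h1) fun h3 => h2 ((h σ).2 ⟨h1, h3.symm⟩)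
  have hρv := ((h ρ).1 hρ).2
  obtain ⟨ε, ⟨hε1, hε2⟩, hε⟩ := (hη.2.and self_mem_nhdsWithin).exists
  have hε0 : (0 : ℝ) < ε := hε
  have h1 := hpos _ hε1 hε2
  have h2 := hpos _ hω hωF
  have h3 := apply_eq_zero_of_mem_vectorSpan (fun σ hσ => ((h σ).1 hσ).2)
    (hF.sub_smul_sub_mem_vectorSpan hρ hη.1 hS hηS hγ hω)
  simp only [LinearMap.sub_apply, LinearMap.add_apply, LinearMap.smul_apply, smul_eq_mul,
    hρv] at h1 h3
  have h4 : 0 < η v := pos_of_mul_pos_right (by linarith : 0 < ε * η v) hε0.le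
  exact pos_of_mul_pos_left (by linarith : 0 < (ω S - γ S) * η v) h4.le

end Affine

namespace GeneralizedFunctionalTheory

variable {V H : Type*} [AddCommGroup V] [Module ℝ V]
  [NormedAddCommGroup H] [InnerProductSpace ℂ H] [FiniteDimensional ℂ H]
  {T : GeneralizedFunctionalTheory V H} {F : Set (Module.Dual ℝ V)}

/-! ### Regular values of the facet density map -/

variable (T) in
/-- The weights occurring in the weight decomposition of a vector. -/
def weightSupport (x : H) : Set (Module.Dual ℝ V) := {ω | T.weightProj ω x ≠ 0}

theorem weightSupport_subset (x : H) : T.weightSupport x ⊆ T.weights := fun _ hω =>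
  T.mem_weights_of_ne_zero (T.weightProj_mem _ _) hω

theorem weightProj_eq_zero {x : H} {ω : Module.Dual ℝ V} (h : ω ∉ T.weightSupport x) :
    T.weightProj ω x = 0 := not_not.1 h

theorem weightSupport_nonempty (hT : T.IsAbelian) {x : H} (hx : ‖x‖ = 1) :
    (T.weightSupport x).Nonempty := by
  by_contra h
  rw [Set.not_nonempty_iff_eq_empty] at h
  have : x = 0 := ext_weightProj hT fun ω _ => by
    rw [map_zero, weightProj_eq_zero (h ▸ Set.notMem_empty ω)]
  simp [this] at hx

theorem coe_weightFinset_subset_convexHull :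
    (T.weightFinset : Set (Module.Dual ℝ V)) ⊆ convexHull ℝ T.weights := by
  rw [coe_weightFinset]; exact subset_convexHull ℝ _

/-- A state with density on the facet is supported on the weights of the facet. -/
theorem weightSupport_subset_facet (hT : T.IsAbelian) (hF : IsFacet (convexHull ℝ T.weights) F)
    {x : H} (hx : ‖x‖ = 1) (hρ : T.densityMap (ketBra x) ∈ F) : T.weightSupport x ⊆ F := by
  intro ω hω
  rw [densityMap_ketBra hT] at hρ
  refine hF.mem_of_sum_smul_mem coe_weightFinset_subset_convexHull (fun _ _ => sq_nonneg _) ?_ hρ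
    (T.mem_weightFinset.2 (weightSupport_subset x hω)) (pow_ne_zero 2 (norm_ne_zero_iff.2 hω))
  rw [← norm_sq_eq_sum hT, hx, one_pow]

theorem densityMap_mem_convexHull (hT : T.IsAbelian) {x : H} (hx : ‖x‖ = 1) :
    T.densityMap (ketBra x) ∈ convexHull ℝ T.weights := by
  rw [densityMap_ketBra hT, ← coe_weightFinset, Finset.mem_convexHull']
  exact ⟨_, fun _ _ => sq_nonneg _, by rw [← norm_sq_eq_sum hT, hx, one_pow], rfl⟩

theorem densityMap_mem_convexHull_weightSupport (hT : T.IsAbelian) {x : H} (hx : ‖x‖ = 1) :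
    T.densityMap (ketBra x) ∈ convexHull ℝ (T.weightSupport x) := by
  classical
  have hcoe : T.weightSupport x = (T.weightFinset.filter (· ∈ T.weightSupport x) : Finset _) := by
    ext ω
    simpa using fun h => weightSupport_subset x h
  rw [hcoe, Finset.mem_convexHull']
  have hz : ∀ ω ∈ T.weightFinset, ω ∉ T.weightFinset.filter (· ∈ T.weightSupport x) →
      ‖T.weightProj ω x‖ ^ 2 = 0 := fun ω h1 h2 => by
    rw [weightProj_eq_zero fun h => h2 (Finset.mem_filter.2 ⟨h1, h⟩)]; simp
  refine ⟨fun ω => ‖T.weightProj ω x‖ ^ 2, fun _ _ => sq_nonneg _, ?_, ?_⟩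
  · rw [Finset.sum_subset (Finset.filter_subset _ _) hz, ← norm_sq_eq_sum hT, hx, one_pow]
  · rw [densityMap_ketBra hT]
    exact Finset.sum_subset (Finset.filter_subset _ _) fun ω h1 h2 => by
      simp only [hz ω h1 h2, zero_smul]

/-- Every convex combination of weights is the density of a state with the prescribed
squared norms of the weight components. -/
theorem exists_state_of_mem_convexHull (hT : T.IsAbelian) {s : Finset (Module.Dual ℝ V)}
    (hs : (s : Set (Module.Dual ℝ V)) ⊆ T.weights) {σ : Module.Dual ℝ V}
    (hσ : σ ∈ convexHull ℝ (s : Set (Module.Dual ℝ V))) :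
    ∃ x : H, ‖x‖ = 1 ∧ T.densityMap (ketBra x) = σ ∧ T.weightSupport x ⊆ s := by
  classical
  obtain ⟨p, hp, h1, h2⟩ := Finset.mem_convexHull'.1 hσ
  have hsub : s ⊆ T.weightFinset := fun ω h => T.mem_weightFinset.2 (hs h)
  obtain ⟨x, hx⟩ := T.exists_norm_weightProj_sq_eq (fun ω => if ω ∈ s then p ω else 0)
    (fun ω _ => by split_ifs with h; exacts [hp ω h, le_rfl])
  have hx' : ∀ ω ∈ T.weightFinset, ‖T.weightProj ω x‖ ^ 2 = if ω ∈ s then p ω else 0 :=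
    fun ω h => hx ω (T.mem_weightFinset.1 h)
  refine ⟨x, ?_, ?_, fun ω hω => ?_⟩
  · have : ‖x‖ ^ 2 = 1 := by
      rw [norm_sq_eq_sum hT, Finset.sum_congr rfl hx', ← h1,
        ← Finset.sum_subset hsub fun ω _ h => if_neg h]
      exact Finset.sum_congr rfl fun ω h => if_pos h
    nlinarith [norm_nonneg x]
  · rw [densityMap_ketBra hT, ← h2,
      ← Finset.sum_subset hsub fun ω h h' => by rw [hx' ω h, if_neg h', zero_smul]]
    exact Finset.sum_congr rfl fun ω h => by rw [hx' ω (hsub h), if_pos h]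
  · by_contra h
    have h3 := hx ω (weightSupport_subset x hω)
    rw [if_neg (Finset.mem_coe.not.1 h)] at h3
    exact hω (norm_eq_zero.1 (pow_eq_zero_iff two_ne_zero |>.1 h3))

theorem mem_facetSpace_iff (hT : T.IsAbelian) {x : H} :
    x ∈ ⨆ ω ∈ T.weights ∩ F, T.weightSpace ω ↔ T.weightSupport x ⊆ F := by
  constructor
  · intro hx ω hω
    by_contra hωF
    refine hω ?_
    have hle : ⨆ ω ∈ T.weights ∩ F, T.weightSpace ω ≤
        LinearMap.ker (T.weightProj ω : H →ₗ[ℂ] H) :=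
      iSup₂_le fun τ hτ y hy => T.weightProj_of_mem_of_ne (ne_of_mem_of_not_mem hτ.2 hωF) hy
    exact hle hx
  · intro h
    rw [← sum_weightProj hT x]
    refine Submodule.sum_mem _ fun ω _ => ?_
    by_cases hω : ω ∈ T.weightSupport x
    · exact (le_iSup₂ (f := fun ω (_ : ω ∈ T.weights ∩ F) => T.weightSpace ω) ω
        ⟨weightSupport_subset x hω, h hω⟩) (T.weightProj_mem _ _)
    · rw [weightProj_eq_zero hω]; exact Submodule.zero_mem _

theorem inner_facetTheory_ι (v : V) (x y : ↥(⨆ ω ∈ T.weights ∩ F, T.weightSpace ω)) :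
    ⟪x, ((T.facetTheory F).ι v : _ →ₗ[ℂ] _) y⟫_ℂ = ⟪(x : H), (T.ι v : H →ₗ[ℂ] H) y⟫_ℂ :=
  Submodule.inner_orthogonalProjectionOnto_eq_of_mem_left _ _

theorem facetTheory_densityMap_ketBra (x : ↥(⨆ ω ∈ T.weights ∩ F, T.weightSpace ω)) :
    (T.facetTheory F).densityMap (ketBra x) = T.densityMap (ketBra (x : H)) := by
  ext v
  exact congrArg Complex.re (inner_facetTheory_ι v x x)

variable (T) in
theorem fderiv_densityMap_ketBra (v : V) (x φ : H) :
    fderiv ℝ (fun y : H => T.densityMap (ketBra y) v) x φ =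
      2 * (⟪x, (T.ι v : H →ₗ[ℂ] H) φ⟫_ℂ).re := by
  let A : H →L[ℝ] H := (LinearMap.toContinuousLinearMap (T.ι v : H →ₗ[ℂ] H)).restrictScalars ℝ
  have h : HasFDerivAt (fun y : H => (⟪y, A y⟫_ℂ).re) _ x :=
    Complex.reCLM.hasFDerivAt.comp x ((hasFDerivAt_id x).inner ℂ A.hasFDerivAt)
  have h' : HasFDerivAt (fun y : H => T.densityMap (ketBra y) v) _ x := h
  rw [h'.fderiv]
  have hs : ⟪φ, (T.ι v : H →ₗ[ℂ] H) x⟫_ℂ = starRingEnd ℂ ⟪x, (T.ι v : H →ₗ[ℂ] H) φ⟫_ℂ := by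
    rw [inner_conj_symm]; exact (isSymmetric_herm (T.ι v) φ x).symm
  have h2 : (⟪x, A φ⟫_ℂ + ⟪φ, A x⟫_ℂ).re = 2 * (⟪x, (T.ι v : H →ₗ[ℂ] H) φ⟫_ℂ).re := by
    change (⟪x, (T.ι v : H →ₗ[ℂ] H) φ⟫_ℂ + ⟪φ, (T.ι v : H →ₗ[ℂ] H) x⟫_ℂ).re = _
    rw [hs, Complex.add_re, Complex.conj_re, two_mul]
  exact h2

theorem facetTheory_image_pureStates (hT : T.IsAbelian) (hF : IsFacet (convexHull ℝ T.weights) F) :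
    (T.facetTheory F).densityMap '' pureStates _ = F := by
  ext σ
  constructor
  · rintro ⟨_, ⟨x, hx, rfl⟩, rfl⟩
    rw [facetTheory_densityMap_ketBra]
    have hx' : ‖(x : H)‖ = 1 := hx
    have hsupp := (mem_facetSpace_iff hT).1 x.2
    obtain ⟨v, c, -, h⟩ := hF.exists_supporting
    refine (h _).2 ⟨densityMap_mem_convexHull hT hx', ?_⟩
    have h1 := norm_sq_eq_sum hT (x : H)
    rw [hx', one_pow] at h1
    rw [densityMap_ketBra_apply hT, ← mul_one c, h1, Finset.mul_sum]
    refine Finset.sum_congr rfl fun ω _ => ?_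
    by_cases hω : ω ∈ T.weightSupport (x : H)
    · rw [((h ω).1 (hsupp hω)).2, mul_comm]
    · rw [weightProj_eq_zero hω]; simp
  · intro hσ
    have hσ' := hF.subset hσ
    rw [← coe_weightFinset] at hσ'
    obtain ⟨x, hx, hxσ, -⟩ := exists_state_of_mem_convexHull hT T.coe_weightFinset.subset hσ'
    have hmem := (mem_facetSpace_iff hT).2 (weightSupport_subset_facet hT hF hx (hxσ ▸ hσ))
    exact ⟨_, ⟨⟨x, hmem⟩, hx, rfl⟩, (facetTheory_densityMap_ketBra _).trans hxσ⟩

/-- The differential of the density map at `Ψ` maps the vectors tangent to the sphere of states of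
the facet theory onto the translation space of the affine span of the weights occurring in `Ψ`. -/
theorem facetTheory_isRegularValue_iff (hT : T.IsAbelian)
    (hF : IsFacet (convexHull ℝ T.weights) F) {ρ : Module.Dual ℝ V} (hρ : ρ ∈ F) :
    (T.facetTheory F).IsRegularValue ρ ↔ ∀ x : H, ‖x‖ = 1 → T.densityMap (ketBra x) = ρ →
      vectorSpan ℝ F ≤ vectorSpan ℝ (T.weightSupport x) := by
  classical
  have hsum : ∀ (x φ : H) (v : V), 2 * (⟪x, (T.ι v : H →ₗ[ℂ] H) φ⟫_ℂ).re =
      (∑ ω ∈ T.weightFinset, (2 * (⟪T.weightProj ω x, T.weightProj ω φ⟫_ℂ).re) • ω) v := by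
    intro x φ v
    rw [inner_ι_eq_sum hT, LinearMap.sum_apply, Finset.mul_sum]
    exact Finset.sum_congr rfl fun ω _ => (mul_assoc _ _ _).symm
  rw [IsRegularValue, facetTheory_image_pureStates hT hF]
  constructor
  · intro h x hx hxρ α hα
    have hmem := (mem_facetSpace_iff hT).2 (weightSupport_subset_facet hT hF hx (hxρ ▸ hρ))
    obtain ⟨φ, hφ, hd⟩ := h ⟨x, hmem⟩ hx ((facetTheory_densityMap_ketBra _).trans hxρ) α hα
    have hα' : α = ∑ ω ∈ T.weightFinset,
        (2 * (⟪T.weightProj ω x, T.weightProj ω (φ : H)⟫_ℂ).re) • ω := by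
      ext v
      rw [← hsum, ← hd v, fderiv_densityMap_ketBra, inner_facetTheory_ι]
    rw [hα']
    refine sum_smul_mem_vectorSpan (weightSupport_nonempty hT hx)
      (fun ω hω => by rw [weightProj_eq_zero hω]; simp) ?_
    have hφ' : ⟪x, (φ : H)⟫_ℂ = 0 := hφ
    rw [← Finset.mul_sum, ← Complex.re_sum, ← inner_eq_sum hT, hφ', Complex.zero_re, mul_zero]
  · intro h x hx hxρ α hα
    rw [facetTheory_densityMap_ketBra] at hxρ
    obtain ⟨c, hc, h0, rfl⟩ := exists_sum_smul_eq_of_mem_vectorSpan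
      (t := T.weightFinset) (by rw [coe_weightFinset]; exact weightSupport_subset _)
      (h x hx hxρ hα)
    -- Moving the weight component of `x` at `ω` radially shifts the density along `ω` only.
    let a : Module.Dual ℝ V → ℝ := fun ω => c ω / (2 * ‖T.weightProj ω (x : H)‖ ^ 2)
    let y : Module.Dual ℝ V → H := fun ω => ((a ω : ℝ) : ℂ) • T.weightProj ω (x : H)
    have hy : ∀ ω, y ω ∈ T.weightSpace ω := fun ω => Submodule.smul_mem _ _ (T.weightProj_mem _ _)
    have hproj : ∀ ω ∈ T.weights, T.weightProj ω (∑ τ ∈ T.weightFinset, y τ) = y ω := fun ω hω => by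
      rw [T.weightProj_sum _ _ hy, if_pos (T.mem_weightFinset.2 hω)]
    have hinner : ∀ ω ∈ T.weightFinset, ⟪T.weightProj ω (x : H),
        T.weightProj ω (∑ τ ∈ T.weightFinset, y τ)⟫_ℂ = ((c ω / 2 : ℝ) : ℂ) := fun ω hω => by
      rw [hproj ω (T.mem_weightFinset.1 hω)]
      change ⟪_, ((a ω : ℝ) : ℂ) • _⟫_ℂ = _
      rw [inner_smul_right, inner_self_eq_norm_sq_to_K]
      by_cases hω' : ω ∈ T.weightSupport (x : H)
      · have hne : ‖T.weightProj ω (x : H)‖ ≠ 0 := norm_ne_zero_iff.2 hω'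
        have : a ω * ‖T.weightProj ω (x : H)‖ ^ 2 = c ω / 2 := by
          simp only [a]; field_simp
        rw [← this]; push_cast; rfl
      · rw [weightProj_eq_zero hω', hc ω hω']; simp
    have hφ : ∑ τ ∈ T.weightFinset, y τ ∈ ⨆ ω ∈ T.weights ∩ F, T.weightSpace ω := by
      rw [mem_facetSpace_iff hT]
      intro ω hω
      refine (mem_facetSpace_iff hT).1 x.2 fun h0 => hω ?_
      rw [hproj ω (weightSupport_subset _ hω)]
      simp only [y, h0, smul_zero]
    refine ⟨⟨_, hφ⟩, ?_, fun v => ?_⟩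
    · change ⟪(x : H), ∑ τ ∈ T.weightFinset, y τ⟫_ℂ = 0
      rw [inner_eq_sum hT, Finset.sum_congr rfl hinner, ← Complex.ofReal_sum, ← Finset.sum_div, h0]
      simp
    · rw [fderiv_densityMap_ketBra, inner_facetTheory_ι, hsum]
      congr 1
      refine Finset.sum_congr rfl fun ω hω => ?_
      rw [hinner ω hω, Complex.ofReal_re, mul_div_cancel₀ _ two_ne_zero]

/-- A density is the convex combination of few weights if and only if it is the density of a state
whose weights span too small an affine space: one direction is Carathéodory's theorem, the other a
count of dimensions. -/
theorem facetTheory_isRegularValue_iff_not_mem_convexHull [FiniteDimensional ℝ V] (hT : T.IsAbelian)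
    (hF : IsFacet (convexHull ℝ T.weights) F) {ρ : Module.Dual ℝ V} (hρ : ρ ∈ F) :
    (T.facetTheory F).IsRegularValue ρ ↔
      ¬ ∃ s : Finset (Module.Dual ℝ V), (s : Set (Module.Dual ℝ V)) ⊆ T.weights ∧
        s.card ≤ Module.finrank ℝ (vectorSpan ℝ F) ∧
        ρ ∈ convexHull ℝ (s : Set (Module.Dual ℝ V)) := by
  rw [facetTheory_isRegularValue_iff hT hF hρ]
  constructor
  · rintro h ⟨s, hs, hcard, hmem⟩
    obtain ⟨x, hx, hxρ, hsupp⟩ := exists_state_of_mem_convexHull hT hs hmem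
    have hle := Submodule.finrank_mono ((h x hx hxρ).trans (vectorSpan_mono ℝ hsupp))
    have hne : Nonempty s := by
      obtain ⟨ω, hω⟩ := weightSupport_nonempty hT hx
      exact ⟨⟨ω, hsupp hω⟩⟩
    have hr := finrank_vectorSpan_range_add_one_le ℝ ((↑) : s → Module.Dual ℝ V)
    rw [Subtype.range_coe_subtype, Fintype.card_coe] at hr
    have hset : {x | x ∈ s} = (s : Set (Module.Dual ℝ V)) := rfl
    rw [hset] at hr
    omega
  · intro h x hx hxρ
    by_contra hnle
    have hsub := weightSupport_subset_facet hT hF hx (hxρ ▸ hρ)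
    have hlt : vectorSpan ℝ (T.weightSupport x) < vectorSpan ℝ F :=
      lt_of_le_not_ge (vectorSpan_mono ℝ hsub) hnle
    have hfr := Submodule.finrank_lt_finrank_of_lt hlt
    have hmem := densityMap_mem_convexHull_weightSupport hT hx
    rw [hxρ, convexHull_eq_union] at hmem
    simp only [Set.mem_iUnion] at hmem
    obtain ⟨t, ht, hind, hmem⟩ := hmem
    refine h ⟨t, ht.trans (weightSupport_subset x), ?_, hmem⟩
    have hne : Nonempty t := by
      obtain ⟨τ, hτ⟩ := convexHull_nonempty_iff.1 ⟨ρ, hmem⟩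
      exact ⟨⟨τ, hτ⟩⟩
    have hc := hind.finrank_vectorSpan_add_one
    rw [Subtype.range_coe_subtype, Fintype.card_coe] at hc
    have hset : {x | x ∈ t} = (t : Set (Module.Dual ℝ V)) := rfl
    rw [hset] at hc
    have := Submodule.finrank_mono (vectorSpan_mono ℝ ht)
    omega

/-! ### Constrained search -/

theorem continuous_ketBra (A : Herm H) : Continuous fun x : H => ketBra x A :=
  Complex.continuous_re.comp
    (continuous_id.inner (LinearMap.continuous_of_finiteDimensional (A : H →ₗ[ℂ] H)))

theorem ketBra_add (A : Herm H) (x y : H) : ketBra (x + y) A =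
    ketBra x A + 2 * (⟪y, (A : H →ₗ[ℂ] H) x⟫_ℂ).re + ketBra y A := by
  have hs : ⟪x, (A : H →ₗ[ℂ] H) y⟫_ℂ = starRingEnd ℂ ⟪y, (A : H →ₗ[ℂ] H) x⟫_ℂ := by
    rw [inner_conj_symm]; exact (isSymmetric_herm A x y).symm
  change (⟪x + y, (A : H →ₗ[ℂ] H) (x + y)⟫_ℂ).re = (⟪x, (A : H →ₗ[ℂ] H) x⟫_ℂ).re +
    2 * (⟪y, (A : H →ₗ[ℂ] H) x⟫_ℂ).re + (⟪y, (A : H →ₗ[ℂ] H) y⟫_ℂ).re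
  rw [map_add, inner_add_left, inner_add_right, inner_add_right, hs]
  simp only [Complex.add_re, Complex.conj_re]
  ring

theorem exists_abs_re_inner_le (A : Herm H) : ∃ M : ℝ, 0 ≤ M ∧ ∀ x y : H,
    |(⟪x, (A : H →ₗ[ℂ] H) y⟫_ℂ).re| ≤ M * (‖x‖ * ‖y‖) := by
  refine ⟨‖LinearMap.toContinuousLinearMap (A : H →ₗ[ℂ] H)‖, norm_nonneg _, fun x y => ?_⟩
  refine (Complex.abs_re_le_norm _).trans ((norm_inner_le_norm _ _).trans ?_)
  have := (LinearMap.toContinuousLinearMap (A : H →ₗ[ℂ] H)).le_opNorm y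
  calc _ ≤ ‖x‖ * (_ * ‖y‖) := mul_le_mul_of_nonneg_left this (norm_nonneg x)
    _ = _ := by ring

theorem pureFunctional_le {σ : Module.Dual ℝ V} {x : H} (hx : ‖x‖ = 1)
    (hσ : T.densityMap (ketBra x) = σ) : T.pureFunctional σ ≤ ketBra x T.W :=
  (T.isLeast_pureFunctional σ ⟨_, ⟨x, hx, rfl⟩, hσ⟩).2 ⟨_, ⟨⟨x, hx, rfl⟩, hσ⟩, rfl⟩

theorem exists_ketBra_eq_pureFunctional (hT : T.IsAbelian) {σ : Module.Dual ℝ V}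
    (hσ : σ ∈ convexHull ℝ T.weights) : ∃ x : H, ‖x‖ = 1 ∧ T.densityMap (ketBra x) = σ ∧
      ketBra x T.W = T.pureFunctional σ := by
  rw [← coe_weightFinset] at hσ
  obtain ⟨x, hx, hxσ, -⟩ := exists_state_of_mem_convexHull hT T.coe_weightFinset.subset hσ
  obtain ⟨_, ⟨⟨y, hy, rfl⟩, hyσ⟩, h⟩ :=
    (T.isLeast_pureFunctional σ ⟨_, ⟨x, hx, rfl⟩, hxσ⟩).1
  exact ⟨y, hy, hyσ, h⟩

theorem isMinimizer_iff {σ : Module.Dual ℝ V} {x : H} : T.IsMinimizer σ x ↔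
    ‖x‖ = 1 ∧ T.densityMap (ketBra x) = σ ∧ ketBra x T.W ≤ T.pureFunctional σ := by
  constructor
  · rintro ⟨hx, hfib, hmin⟩
    refine ⟨hx, hfib.2, ?_⟩
    obtain ⟨Γ, hΓ, h⟩ := (T.isLeast_pureFunctional σ ⟨_, hfib⟩).1
    exact (hmin hΓ).trans h.le
  · rintro ⟨hx, hσ, hle⟩
    refine ⟨hx, ⟨⟨x, hx, rfl⟩, hσ⟩, ?_⟩
    rintro _ ⟨⟨y, hy, rfl⟩, hyσ⟩
    exact hle.trans (pureFunctional_le hy hyσ)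

theorem isCompact_setOf_isMinimizer (σ : Module.Dual ℝ V) :
    IsCompact {x : H | T.IsMinimizer σ x} := by
  have : ProperSpace H := FiniteDimensional.proper ℂ H
  have hset : {x : H | T.IsMinimizer σ x} = Metric.sphere (0 : H) 1 ∩
      ((⋂ v : V, {x : H | ketBra x (T.ι v) = σ v}) ∩ {x | ketBra x T.W ≤ T.pureFunctional σ}) := by
    ext x
    rw [Set.mem_ofPred_eq, isMinimizer_iff, Set.mem_inter_iff, Set.mem_inter_iff, Set.mem_iInter,
      mem_sphere_zero_iff_norm]
    exact and_congr_right fun _ => and_congr_left fun _ =>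
      ⟨fun h v => LinearMap.congr_fun h v, fun h => LinearMap.ext h⟩
  rw [hset]
  exact (isCompact_sphere _ _).inter_right ((isClosed_iInter fun v =>
    isClosed_eq (continuous_ketBra _) continuous_const).inter
      (isClosed_le (continuous_ketBra _) continuous_const))

theorem continuous_boundaryForce (S : V) (γ : Module.Dual ℝ V) :
    Continuous (T.boundaryForce F S γ) := by
  have hW : Continuous (T.W : H →ₗ[ℂ] H) := LinearMap.continuous_of_finiteDimensional _
  refine continuous_const.mul (Real.continuous_sqrt.comp (continuous_finsetSum _ fun ω _ => ?_))
  exact ((((T.weightSpace ω).orthogonalProjectionOnto.continuous.comp hW).norm).pow 2).div_const _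

theorem exists_isMinimizer_boundaryForce_le (hT : T.IsAbelian) {σ : Module.Dual ℝ V}
    (hσ : σ ∈ convexHull ℝ T.weights) (S : V) (γ : Module.Dual ℝ V) :
    ∃ x : H, T.IsMinimizer σ x ∧
      ∀ y : H, T.IsMinimizer σ y → T.boundaryForce F S γ x ≤ T.boundaryForce F S γ y := by
  obtain ⟨x, hx, hxσ, hE⟩ := exists_ketBra_eq_pureFunctional hT hσ
  obtain ⟨y, hy, hmin⟩ := (T.isCompact_setOf_isMinimizer σ).exists_isMinOn
    ⟨x, isMinimizer_iff.2 ⟨hx, hxσ, hE.le⟩⟩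
    (T.continuous_boundaryForce (F := F) S γ).continuousOn
  exact ⟨y, hy, fun z hz => hmin hz⟩

/-! ### Correcting the density of a state -/

theorem norm_sq_add_of_disjoint (hT : T.IsAbelian) {x y : H}
    (h : ∀ ω ∈ T.weights, T.weightProj ω x = 0 ∨ T.weightProj ω y = 0) :
    ‖x + y‖ ^ 2 = ‖x‖ ^ 2 + ‖y‖ ^ 2 := by
  rw [norm_sq_eq_sum hT (x + y), norm_sq_eq_sum hT x, norm_sq_eq_sum hT y,
    ← Finset.sum_add_distrib]
  refine Finset.sum_congr rfl fun ω hω => ?_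
  rcases h ω (T.mem_weightFinset.1 hω) with h | h <;> simp [h]

theorem densityMap_ketBra_add_of_disjoint (hT : T.IsAbelian) {x y : H}
    (h : ∀ ω ∈ T.weights, T.weightProj ω x = 0 ∨ T.weightProj ω y = 0) :
    T.densityMap (ketBra (x + y)) = T.densityMap (ketBra x) + T.densityMap (ketBra y) := by
  simp only [densityMap_ketBra hT, ← Finset.sum_add_distrib]
  refine Finset.sum_congr rfl fun ω hω => ?_
  rcases h ω (T.mem_weightFinset.1 hω) with h | h <;> simp [h]

theorem abs_sqrt_one_add_sub_one_le {a : ℝ} (ha : -1 ≤ a) : |√(1 + a) - 1| ≤ |a| := by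
  have h0 := Real.sqrt_nonneg (1 + a)
  have hsq := Real.sq_sqrt (by linarith : 0 ≤ 1 + a)
  have : a = (√(1 + a) - 1) * (√(1 + a) + 1) := by nlinarith
  conv_rhs => rw [this, abs_mul]
  exact le_mul_of_one_le_right (abs_nonneg _) (by rw [abs_of_nonneg (by linarith)]; linarith)

/-- If the points `u ω` are affine combinations of the weights occurring in `Φ`, the density of any
state near `Φ` can be changed by a small amount `∑ q_ω u_ω`, and its squared norm by `∑ q_ω`, at
the cost of a change of the state that is linear in `q`. It suffices to rescale the weight
components which occur in `Φ`: these are bounded away from zero. -/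
theorem exists_density_correction (hT : T.IsAbelian) (Φ : H) (s : Finset (Module.Dual ℝ V))
    (u : Module.Dual ℝ V → Module.Dual ℝ V)
    (hu : ∀ ω ∈ s, ∃ c : Module.Dual ℝ V → ℝ, (∀ τ, τ ∉ T.weightSupport Φ → c τ = 0) ∧
      ∑ τ ∈ T.weightFinset, c τ = 1 ∧ ∑ τ ∈ T.weightFinset, c τ • τ = u ω) :
    ∃ C r : ℝ, 0 ≤ C ∧ 0 < r ∧ ∀ x : H, ‖x - Φ‖ < r → ∀ t : ℝ, 0 ≤ t → t < r →
      ∀ q : Module.Dual ℝ V → ℝ, (∀ ω ∈ s, |q ω| ≤ t) →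
        ∃ x' : H, ‖x' - x‖ ≤ C * t ∧ ‖x'‖ ^ 2 = ‖x‖ ^ 2 + ∑ ω ∈ s, q ω ∧
          T.densityMap (ketBra x') = T.densityMap (ketBra x) + ∑ ω ∈ s, q ω • u ω := by
  classical
  choose! c hc0 hc1 hcu using hu
  -- Components of vectors within `m` of `Φ` keep norm at least `m` on the support of `Φ`.
  obtain ⟨m, hm, hm0⟩ : ∃ m : ℝ, (∀ τ ∈ T.weightFinset, τ ∈ T.weightSupport Φ →
      2 * m < ‖T.weightProj τ Φ‖) ∧ 0 < m := by
    have : ∀ᶠ m : ℝ in 𝓝[>] 0, ∀ τ ∈ T.weightFinset, τ ∈ T.weightSupport Φ →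
        2 * m < ‖T.weightProj τ Φ‖ := by
      refine (Filter.eventually_all_finset _).2 fun τ _ => ?_
      by_cases hτ : τ ∈ T.weightSupport Φ
      · have hcont : Tendsto (fun m : ℝ => 2 * m) (𝓝[>] 0) (𝓝 (2 * 0)) :=
          (continuous_const.mul continuous_id).continuousWithinAt
        rw [mul_zero] at hcont
        filter_upwards [hcont.eventually (gt_mem_nhds (norm_pos_iff.2 hτ))] with m hm _ using hm
      · exact Eventually.of_forall fun m h => absurd h hτ
    obtain ⟨m, h1, h2⟩ := (this.and self_mem_nhdsWithin).exists
    exact ⟨m, h1, h2⟩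
  set B : ℝ := ∑ ω ∈ s, ∑ τ ∈ T.weightFinset, |c ω τ| with hB
  have hB0 : 0 ≤ B := Finset.sum_nonneg fun _ _ => Finset.sum_nonneg fun _ _ => abs_nonneg _
  refine ⟨T.weightFinset.card * (B / m), min m (m ^ 2 / (B + 1)), by positivity,
    lt_min hm0 (by positivity), fun x hx t ht0 ht q hq => ?_⟩
  have hxm : ‖x - Φ‖ < m := hx.trans_le (min_le_left _ _)
  have htm : t * B ≤ m ^ 2 := by
    have h1 := (lt_div_iff₀ (by linarith : 0 < B + 1)).1 (ht.trans_le (min_le_right _ _))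
    nlinarith
  let k : Module.Dual ℝ V → ℝ := fun τ => ∑ ω ∈ s, q ω * c ω τ
  have hk0 : ∀ τ, τ ∉ T.weightSupport Φ → k τ = 0 := fun τ hτ =>
    Finset.sum_eq_zero fun ω hω => by rw [hc0 ω hω τ hτ, mul_zero]
  have hkB : ∀ τ ∈ T.weightFinset, |k τ| ≤ t * B := fun τ hτ => by
    refine (Finset.abs_sum_le_sum_abs _ _).trans ?_
    rw [hB, Finset.mul_sum]
    refine Finset.sum_le_sum fun ω hω => ?_
    rw [abs_mul]
    exact mul_le_mul (hq ω hω) (Finset.single_le_sum (f := fun τ => |c ω τ|)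
      (fun _ _ => abs_nonneg _) hτ) (abs_nonneg _) ht0
  have hpm : ∀ τ ∈ T.weightFinset, τ ∈ T.weightSupport Φ → m < ‖T.weightProj τ x‖ := by
    intro τ hτ hτ'
    have h1 := hm τ hτ hτ'
    have h2 := T.norm_weightProj_le τ (x - Φ)
    have h3 : ‖T.weightProj τ Φ‖ ≤ ‖T.weightProj τ x‖ + ‖T.weightProj τ (x - Φ)‖ := by
      have : T.weightProj τ Φ = T.weightProj τ x - T.weightProj τ (x - Φ) := by
        rw [map_sub, sub_sub_cancel]
      rw [this]; exact norm_sub_le _ _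
    linarith
  let f : Module.Dual ℝ V → ℝ := fun τ => √(1 + k τ / ‖T.weightProj τ x‖ ^ 2)
  let y : Module.Dual ℝ V → H := fun τ => ((f τ : ℝ) : ℂ) • T.weightProj τ x
  have hy : ∀ τ, y τ ∈ T.weightSpace τ := fun τ => Submodule.smul_mem _ _ (T.weightProj_mem _ _)
  have hproj : ∀ τ ∈ T.weightFinset, T.weightProj τ (∑ τ ∈ T.weightFinset, y τ) = y τ :=
    fun τ hτ => by rw [T.weightProj_sum _ _ hy, if_pos hτ]
  have hge : ∀ τ ∈ T.weightFinset, -1 ≤ k τ / ‖T.weightProj τ x‖ ^ 2 := by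
    intro τ hτ
    by_cases hτ' : τ ∈ T.weightSupport Φ
    · have h1 := hpm τ hτ hτ'
      have h2 := (abs_le.1 (hkB τ hτ)).1
      rw [le_div_iff₀ (pow_pos (hm0.trans h1) 2)]
      nlinarith
    · rw [hk0 τ hτ', zero_div]; norm_num
  have hnorm : ∀ τ ∈ T.weightFinset, ‖T.weightProj τ (∑ τ ∈ T.weightFinset, y τ)‖ ^ 2 =
      ‖T.weightProj τ x‖ ^ 2 + k τ := by
    intro τ hτ
    rw [hproj τ hτ]
    simp only [y, f]
    rw [norm_smul, mul_pow, Complex.norm_real, Real.norm_eq_abs, sq_abs,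
      Real.sq_sqrt (by linarith [hge τ hτ])]
    by_cases hτ' : τ ∈ T.weightSupport Φ
    · have h1 := (hm0.trans (hpm τ hτ hτ')).ne'
      field_simp
    · rw [hk0 τ hτ']; simp
  have hdiff : ∀ τ ∈ T.weightFinset, ‖y τ - T.weightProj τ x‖ ≤ t * B / m := by
    intro τ hτ
    have h1 : y τ - T.weightProj τ x = ((f τ - 1 : ℝ) : ℂ) • T.weightProj τ x := by
      simp only [y]; push_cast; rw [sub_smul, one_smul]
    rw [h1, norm_smul, Complex.norm_real, Real.norm_eq_abs]
    by_cases hτ' : τ ∈ T.weightSupport Φ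
    · have h2 := hpm τ hτ hτ'
      have h3 := hm0.trans h2
      calc |f τ - 1| * ‖T.weightProj τ x‖
          ≤ |k τ / ‖T.weightProj τ x‖ ^ 2| * ‖T.weightProj τ x‖ :=
            mul_le_mul_of_nonneg_right (abs_sqrt_one_add_sub_one_le (hge τ hτ)) h3.le
        _ = |k τ| / ‖T.weightProj τ x‖ := by
            rw [abs_div, abs_of_pos (pow_pos h3 2)]; field_simp
        _ ≤ t * B / m := div_le_div₀ (by positivity) (hkB τ hτ) hm0 h2.le
    · have : f τ = 1 := by simp only [f]; rw [hk0 τ hτ']; simp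
      rw [this, sub_self, abs_zero, zero_mul]; positivity
  refine ⟨∑ τ ∈ T.weightFinset, y τ, ?_, ?_, ?_⟩
  · have : ∑ τ ∈ T.weightFinset, y τ - x = ∑ τ ∈ T.weightFinset, (y τ - T.weightProj τ x) := by
      rw [Finset.sum_sub_distrib, sum_weightProj hT]
    rw [this]
    refine (norm_sum_le_of_le _ hdiff).trans (le_of_eq ?_)
    rw [Finset.sum_const, nsmul_eq_mul]; ring
  · rw [norm_sq_eq_sum hT, Finset.sum_congr rfl hnorm, Finset.sum_add_distrib, ← norm_sq_eq_sum hT,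
      Finset.sum_comm]
    congr 1
    refine Finset.sum_congr rfl fun ω hω => ?_
    rw [← Finset.mul_sum, hc1 ω hω, mul_one]
  · rw [densityMap_ketBra hT, Finset.sum_congr rfl fun τ hτ => by rw [hnorm τ hτ, add_smul],
      Finset.sum_add_distrib, ← densityMap_ketBra hT]
    congr 1
    simp only [k, Finset.sum_smul]
    rw [Finset.sum_comm]
    refine Finset.sum_congr rfl fun ω hω => ?_
    simp_rw [mul_smul, ← Finset.smul_sum]
    rw [hcu ω hω]

/-! ### Asymptotics of the functional near the facet -/

variable (T F) in
/-- The finite set `Ω ∖ F` of weights off the facet. -/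
noncomputable def offFacet : Finset (Module.Dual ℝ V) :=
  (T.finite_weights.sdiff (t := F)).toFinset

theorem mem_offFacet {ω : Module.Dual ℝ V} : ω ∈ T.offFacet F ↔ ω ∈ T.weights ∧ ω ∉ F := by
  simp [offFacet]

theorem offFacet_subset : T.offFacet F ⊆ T.weightFinset := fun _ h =>
  T.mem_weightFinset.2 (mem_offFacet.1 h).1

variable (T F) in
/-- The modulus `[∑ ‖Π_ω W Φ‖² / (⟨ω, S⟩ - ⟨γ, S⟩)]^{1/2}` of half the boundary force. -/
noncomputable def repulsion (S : V) (γ : Module.Dual ℝ V) (Φ : H) : ℝ :=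
  √(∑ ω ∈ T.offFacet F, ‖T.weightProj ω ((T.W : H →ₗ[ℂ] H) Φ)‖ ^ 2 / (ω S - γ S))

theorem boundaryForce_eq (S : V) (γ : Module.Dual ℝ V) (Φ : H) :
    T.boundaryForce F S γ Φ = -2 * T.repulsion F S γ Φ := rfl

theorem sum_offFacet_eq {E : Type*} [AddCommMonoid E] {x : H}
    (hx : Disjoint (T.weightSupport x) F) {f : Module.Dual ℝ V → E}
    (hf : ∀ ω, T.weightProj ω x = 0 → f ω = 0) :
    ∑ ω ∈ T.weightFinset, f ω = ∑ ω ∈ T.offFacet F, f ω := by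
  refine (Finset.sum_subset offFacet_subset fun ω hω h => hf ω ?_).symm
  refine weightProj_eq_zero fun h' => h (mem_offFacet.2 ⟨T.mem_weightFinset.1 hω, ?_⟩)
  exact Set.disjoint_left.1 hx h'

theorem norm_sq_eq_sum_offFacet (hT : T.IsAbelian) {x : H} (hx : Disjoint (T.weightSupport x) F) :
    ‖x‖ ^ 2 = ∑ ω ∈ T.offFacet F, ‖T.weightProj ω x‖ ^ 2 := by
  rw [norm_sq_eq_sum hT]
  exact sum_offFacet_eq hx fun ω h => by simp [h]

theorem densityMap_ketBra_offFacet (hT : T.IsAbelian) {x : H}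
    (hx : Disjoint (T.weightSupport x) F) :
    T.densityMap (ketBra x) = ∑ ω ∈ T.offFacet F, ‖T.weightProj ω x‖ ^ 2 • ω := by
  rw [densityMap_ketBra hT]
  exact sum_offFacet_eq hx fun ω h => by simp [h]

theorem inner_eq_sum_offFacet (hT : T.IsAbelian) {x : H} (hx : Disjoint (T.weightSupport x) F)
    (y : H) : ⟪x, y⟫_ℂ = ∑ ω ∈ T.offFacet F, ⟪T.weightProj ω x, T.weightProj ω y⟫_ℂ := by
  rw [inner_eq_sum hT]
  exact sum_offFacet_eq hx fun ω h => by simp [h]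

theorem weightProj_eq_zero_or {x y : H} (hx : T.weightSupport x ⊆ F)
    (hy : Disjoint (T.weightSupport y) F) (ω : Module.Dual ℝ V) :
    T.weightProj ω x = 0 ∨ T.weightProj ω y = 0 := by
  by_contra! h
  exact Set.disjoint_left.1 hy h.2 (hx h.1)

theorem densityMap_ketBra_smul (c : ℝ) (x : H) :
    T.densityMap (ketBra ((c : ℂ) • x)) = c ^ 2 • T.densityMap (ketBra x) := by
  ext v
  change (⟪(c : ℂ) • x, (T.ι v : H →ₗ[ℂ] H) ((c : ℂ) • x)⟫_ℂ).re =
    c ^ 2 * (⟪x, (T.ι v : H →ₗ[ℂ] H) x⟫_ℂ).re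
  rw [map_smul, inner_smul_left, inner_smul_right, Complex.conj_ofReal, Complex.re_ofReal_mul,
    Complex.re_ofReal_mul]
  ring

theorem norm_ofReal_smul_sq {E : Type*} [NormedAddCommGroup E] [NormedSpace ℂ E] (c : ℝ) (x : E) :
    ‖(c : ℂ) • x‖ ^ 2 = c ^ 2 * ‖x‖ ^ 2 := by
  rw [norm_smul, mul_pow, Complex.norm_real, Real.norm_eq_abs, sq_abs]

variable (T F) in
/-- The state `Φ` can absorb the shift of the density that arises from occupying a weight off the
facet: up to the admissible multiple of `η`, this weight is an affine combination of the weights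
occurring in `Φ`. -/
def CanAbsorb (S : V) (γ η : Module.Dual ℝ V) (Φ : H) : Prop :=
  ∀ ω ∈ T.offFacet F, ∃ c : Module.Dual ℝ V → ℝ, (∀ τ, τ ∉ T.weightSupport Φ → c τ = 0) ∧
    ∑ τ ∈ T.weightFinset, c τ = 1 ∧ ∑ τ ∈ T.weightFinset, c τ • τ = ω - (ω S - γ S) • η

/-- Admixing `√ε χ` with `χ` off the facet changes the energy to order `√ε`, and the density to
order `ε` only; the latter change is corrected inside the facet space. -/
theorem exists_state_energy_le (hT : T.IsAbelian) {S : V} {γ η ρ : Module.Dual ℝ V} {Φ χ : H}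
    (hΦ : ‖Φ‖ = 1) (hρ : T.densityMap (ketBra Φ) = ρ) (hΦF : T.weightSupport Φ ⊆ F)
    (habs : T.CanAbsorb F S γ η Φ) (hχ : Disjoint (T.weightSupport χ) F)
    (hχ1 : ∑ ω ∈ T.offFacet F, (ω S - γ S) * ‖T.weightProj ω χ‖ ^ 2 = 1) :
    ∃ K : ℝ, ∀ᶠ ε : ℝ in 𝓝[>] 0, ∃ x : H, ‖x‖ = 1 ∧ T.densityMap (ketBra x) = ρ + ε • η ∧
      ketBra x T.W ≤ ketBra Φ T.W + 2 * √ε * (⟪χ, (T.W : H →ₗ[ℂ] H) Φ⟫_ℂ).re + K * ε := by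
  obtain ⟨C, r, hC, hr, hcor⟩ := exists_density_correction hT Φ (T.offFacet F) _ habs
  obtain ⟨M, hM, hW⟩ := exists_abs_re_inner_le T.W
  set D := ‖χ‖ ^ 2 with hD
  have hD0 : 0 ≤ D := sq_nonneg _
  refine ⟨2 * (M * (C * D)) + M * (C * D + ‖χ‖) ^ 2, ?_⟩
  have hlim1 : ∀ᶠ ε : ℝ in 𝓝[>] 0, √ε * ‖χ‖ < r := by
    have : Tendsto (fun ε : ℝ => √ε * ‖χ‖) (𝓝[>] 0) (𝓝 (√0 * ‖χ‖)) :=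
      (Real.continuous_sqrt.mul continuous_const).continuousWithinAt
    rw [Real.sqrt_zero, zero_mul] at this
    exact this.eventually (gt_mem_nhds hr)
  have hlim2 : ∀ᶠ ε : ℝ in 𝓝[>] 0, ε * D < r := by
    have : Tendsto (fun ε : ℝ => ε * D) (𝓝[>] 0) (𝓝 (0 * D)) :=
      (continuous_id.mul continuous_const).continuousWithinAt
    rw [zero_mul] at this
    exact this.eventually (gt_mem_nhds hr)
  have hlim3 : ∀ᶠ ε : ℝ in 𝓝[>] 0, ε < 1 :=
    (tendsto_id.mono_left nhdsWithin_le_nhds).eventually (gt_mem_nhds one_pos)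
  filter_upwards [hlim1, hlim2, hlim3, self_mem_nhdsWithin] with ε h1 h2 h3 hε
  have hε0 : (0 : ℝ) < ε := hε
  set δ := √ε with hδ
  have hδ0 : 0 ≤ δ := Real.sqrt_nonneg _
  have hδsq : δ ^ 2 = ε := Real.sq_sqrt hε0.le
  have hδ1 : δ ≤ 1 := Real.sqrt_le_one.2 h3.le
  have hnδ : ‖(δ : ℂ) • χ‖ = δ * ‖χ‖ := by
    rw [norm_smul, Complex.norm_real, Real.norm_eq_abs, abs_of_nonneg hδ0]
  have hdisj : ∀ ω ∈ T.weights, T.weightProj ω Φ = 0 ∨ T.weightProj ω ((δ : ℂ) • χ) = 0 :=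
    fun ω _ => (weightProj_eq_zero_or hΦF hχ ω).imp_right fun h => by rw [map_smul, h, smul_zero]
  obtain ⟨x', hx', hn, hd⟩ := hcor (Φ + (δ : ℂ) • χ) (by rwa [add_sub_cancel_left, hnδ])
    (ε * D) (by positivity) h2 (fun ω => -(ε * ‖T.weightProj ω χ‖ ^ 2)) (fun ω hω => by
      rw [abs_neg, abs_of_nonneg (by positivity)]
      exact mul_le_mul_of_nonneg_left
        (pow_le_pow_left₀ (norm_nonneg _) (T.norm_weightProj_le ω χ) 2) hε0.le)
  refine ⟨x', ?_, ?_, ?_⟩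
  · rw [norm_sq_add_of_disjoint hT hdisj, norm_ofReal_smul_sq, hδsq, hΦ, Finset.sum_neg_distrib,
      ← Finset.mul_sum, ← norm_sq_eq_sum_offFacet hT hχ] at hn
    have : ‖x'‖ ^ 2 = 1 := by linarith
    nlinarith [norm_nonneg x']
  · rw [hd, densityMap_ketBra_add_of_disjoint hT hdisj, densityMap_ketBra_smul, hδsq, hρ,
      densityMap_ketBra_offFacet hT hχ, add_assoc, Finset.smul_sum, ← Finset.sum_add_distrib]
    congr 1
    have : ∀ ω ∈ T.offFacet F, ε • ‖T.weightProj ω χ‖ ^ 2 • ω +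
        (-(ε * ‖T.weightProj ω χ‖ ^ 2)) • (ω - (ω S - γ S) • η) =
        (ε * ((ω S - γ S) * ‖T.weightProj ω χ‖ ^ 2)) • η := fun ω _ => by module
    rw [Finset.sum_congr rfl this, ← Finset.sum_smul, ← Finset.mul_sum, hχ1, mul_one]
  · set z := x' - (Φ + (δ : ℂ) • χ) with hz
    have hx'eq : x' = Φ + ((δ : ℂ) • χ + z) := by rw [hz]; abel
    have hin : (⟪(δ : ℂ) • χ + z, (T.W : H →ₗ[ℂ] H) Φ⟫_ℂ).re =
        δ * (⟪χ, (T.W : H →ₗ[ℂ] H) Φ⟫_ℂ).re + (⟪z, (T.W : H →ₗ[ℂ] H) Φ⟫_ℂ).re := by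
      rw [inner_add_left, inner_smul_left, Complex.conj_ofReal, Complex.add_re,
        Complex.re_ofReal_mul]
    have hzW := (abs_le.1 (hW z Φ)).2
    rw [hΦ, mul_one] at hzW
    have hzM := mul_le_mul_of_nonneg_left hx' hM
    have hw : ‖(δ : ℂ) • χ + z‖ ≤ δ * (C * D + ‖χ‖) := by
      refine (norm_add_le _ _).trans ?_
      rw [hnδ]
      have : ε ≤ δ := by rw [← hδsq, sq]; exact mul_le_of_le_one_left hδ0 hδ1
      have h4 := mul_le_mul_of_nonneg_right this (mul_nonneg hC hD0)
      nlinarith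
    have hwW := (abs_le.1 (hW ((δ : ℂ) • χ + z) ((δ : ℂ) • χ + z))).2
    have hw2 : M * (‖(δ : ℂ) • χ + z‖ * ‖(δ : ℂ) • χ + z‖) ≤ M * (C * D + ‖χ‖) ^ 2 * ε := by
      have := mul_le_mul_of_nonneg_left (mul_self_le_mul_self (norm_nonneg _) hw) hM
      refine this.trans (le_of_eq ?_)
      rw [← hδsq]; ring
    have hE := ketBra_add T.W Φ ((δ : ℂ) • χ + z)
    rw [hin] at hE
    have hq : ketBra ((δ : ℂ) • χ + z) T.W =
      (⟪(δ : ℂ) • χ + z, (T.W : H →ₗ[ℂ] H) ((δ : ℂ) • χ + z)⟫_ℂ).re := rfl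
    rw [← hx'eq, hq] at hE
    rw [hE]
    linarith

/-- The optimal admixture, for which equality holds in the Cauchy–Schwarz inequality of
`neg_sqrt_mul_repulsion_le`. -/
theorem exists_optimal_admixture (hT : T.IsAbelian) {S : V} {γ : Module.Dual ℝ V}
    (hpos : ∀ ω ∈ T.offFacet F, 0 < ω S - γ S) (hne : (T.offFacet F).Nonempty) (Φ : H) :
    ∃ χ : H, Disjoint (T.weightSupport χ) F ∧
      ∑ ω ∈ T.offFacet F, (ω S - γ S) * ‖T.weightProj ω χ‖ ^ 2 = 1 ∧
      (⟪χ, (T.W : H →ₗ[ℂ] H) Φ⟫_ℂ).re = -T.repulsion F S γ Φ := by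
  classical
  have hdisj : ∀ y : Module.Dual ℝ V → H, (∀ ω, y ω ∈ T.weightSpace ω) →
      Disjoint (T.weightSupport (∑ ω ∈ T.offFacet F, y ω)) F := fun y hy => by
    refine Set.disjoint_left.2 fun ω hω hωF => hω ?_
    rw [T.weightProj_sum _ y hy, if_neg fun h => (mem_offFacet.1 h).2 hωF]
  set g := T.repulsion F S γ Φ with hg
  have hnn : ∀ ω ∈ T.offFacet F,
      0 ≤ ‖T.weightProj ω ((T.W : H →ₗ[ℂ] H) Φ)‖ ^ 2 / (ω S - γ S) := fun ω hω =>
    div_nonneg (sq_nonneg _) (hpos ω hω).le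
  have hgsq : g ^ 2 = ∑ ω ∈ T.offFacet F,
      ‖T.weightProj ω ((T.W : H →ₗ[ℂ] H) Φ)‖ ^ 2 / (ω S - γ S) :=
    Real.sq_sqrt (Finset.sum_nonneg hnn)
  by_cases hg0 : g = 0
  · -- The coupling vanishes, so any normalized admixture off the facet will do.
    rw [hg0, zero_pow two_ne_zero, eq_comm, Finset.sum_eq_zero_iff_of_nonneg hnn] at hgsq
    have hW0 : ∀ ω ∈ T.offFacet F, T.weightProj ω ((T.W : H →ₗ[ℂ] H) Φ) = 0 := fun ω hω => by
      have := (div_eq_zero_iff.1 (hgsq ω hω)).resolve_right (hpos ω hω).ne'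
      exact norm_eq_zero.1 (pow_eq_zero_iff two_ne_zero |>.1 this)
    obtain ⟨x, hx⟩ := T.exists_norm_weightProj_sq_eq (fun ω => if ω ∈ T.offFacet F then
      ((T.offFacet F).card * (ω S - γ S))⁻¹ else 0) (fun ω _ => by
        split_ifs with h
        · exact inv_nonneg.2 (mul_nonneg (Nat.cast_nonneg _) (hpos ω h).le)
        · exact le_rfl)
    have hxF : Disjoint (T.weightSupport x) F := by
      refine Set.disjoint_left.2 fun ω hω hωF => hω ?_
      have := hx ω (weightSupport_subset x hω)
      rw [if_neg fun h => (mem_offFacet.1 h).2 hωF] at this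
      exact norm_eq_zero.1 (pow_eq_zero_iff two_ne_zero |>.1 this)
    refine ⟨x, hxF, ?_, ?_⟩
    · have hcard : ((T.offFacet F).card : ℝ) ≠ 0 := Nat.cast_ne_zero.2 hne.card_pos.ne'
      have : ∀ ω ∈ T.offFacet F, (ω S - γ S) * ‖T.weightProj ω x‖ ^ 2 =
          ((T.offFacet F).card : ℝ)⁻¹ := fun ω hω => by
        have h := (hpos ω hω).ne'
        rw [hx ω (mem_offFacet.1 hω).1, if_pos hω]
        field_simp
      rw [Finset.sum_congr rfl this, Finset.sum_const, nsmul_eq_mul, mul_inv_cancel₀ hcard]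
    · rw [inner_eq_sum_offFacet hT hxF, hg0, neg_zero,
        Finset.sum_eq_zero fun ω hω => by rw [hW0 ω hω, inner_zero_right], Complex.zero_re]
  · let a : Module.Dual ℝ V → ℝ := fun ω => -((ω S - γ S) * g)⁻¹
    let y : Module.Dual ℝ V → H := fun ω =>
      ((a ω : ℝ) : ℂ) • T.weightProj ω ((T.W : H →ₗ[ℂ] H) Φ)
    have hy : ∀ ω, y ω ∈ T.weightSpace ω := fun ω => Submodule.smul_mem _ _ (T.weightProj_mem _ _)
    have hproj : ∀ ω ∈ T.offFacet F, T.weightProj ω (∑ ω ∈ T.offFacet F, y ω) =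
        ((a ω : ℝ) : ℂ) • T.weightProj ω ((T.W : H →ₗ[ℂ] H) Φ) := fun ω hω => by
      rw [T.weightProj_sum _ y hy, if_pos hω]
    refine ⟨∑ ω ∈ T.offFacet F, y ω, hdisj y hy, ?_, ?_⟩
    · have : ∀ ω ∈ T.offFacet F,
          (ω S - γ S) * ‖T.weightProj ω (∑ ω ∈ T.offFacet F, y ω)‖ ^ 2 =
          (g ^ 2)⁻¹ * (‖T.weightProj ω ((T.W : H →ₗ[ℂ] H) Φ)‖ ^ 2 / (ω S - γ S)) :=
        fun ω hω => by
          have h := (hpos ω hω).ne'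
          rw [hproj ω hω, norm_ofReal_smul_sq]
          simp only [a]
          field_simp
      rw [Finset.sum_congr rfl this, ← Finset.mul_sum, ← hgsq, inv_mul_cancel₀ (pow_ne_zero 2 hg0)]
    · rw [inner_eq_sum_offFacet hT (hdisj y hy), Complex.re_sum]
      have : ∀ ω ∈ T.offFacet F, (⟪T.weightProj ω (∑ ω ∈ T.offFacet F, y ω),
          T.weightProj ω ((T.W : H →ₗ[ℂ] H) Φ)⟫_ℂ).re =
          -g⁻¹ * (‖T.weightProj ω ((T.W : H →ₗ[ℂ] H) Φ)‖ ^ 2 / (ω S - γ S)) := fun ω hω => by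
        have h := (hpos ω hω).ne'
        rw [hproj ω hω, inner_smul_left, Complex.conj_ofReal, Complex.re_ofReal_mul,
          inner_self_eq_norm_sq_to_K]
        have : ((‖T.weightProj ω ((T.W : H →ₗ[ℂ] H) Φ)‖ : ℂ) ^ 2).re =
            ‖T.weightProj ω ((T.W : H →ₗ[ℂ] H) Φ)‖ ^ 2 := by norm_cast
        refine (congrArg _ this).trans ?_
        simp only [a]
        field_simp
      rw [Finset.sum_congr rfl this, ← Finset.mul_sum, ← hgsq]
      field_simp

theorem neg_sqrt_mul_repulsion_le (hT : T.IsAbelian) {S : V} {γ : Module.Dual ℝ V}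
    (hpos : ∀ ω ∈ T.offFacet F, 0 < ω S - γ S) {b : H} (hb : Disjoint (T.weightSupport b) F)
    (Φ : H) :
    -(√(∑ ω ∈ T.offFacet F, (ω S - γ S) * ‖T.weightProj ω b‖ ^ 2) * T.repulsion F S γ Φ) ≤
      (⟪b, (T.W : H →ₗ[ℂ] H) Φ⟫_ℂ).re := by
  have h1 := Real.sum_mul_le_sqrt_mul_sqrt (T.offFacet F)
    (fun ω => √(ω S - γ S) * ‖T.weightProj ω b‖)
    (fun ω => ‖T.weightProj ω ((T.W : H →ₗ[ℂ] H) Φ)‖ / √(ω S - γ S))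
  have e1 : ∀ ω ∈ T.offFacet F, (√(ω S - γ S) * ‖T.weightProj ω b‖) ^ 2 =
      (ω S - γ S) * ‖T.weightProj ω b‖ ^ 2 := fun ω hω => by
    rw [mul_pow, Real.sq_sqrt (hpos ω hω).le]
  have e2 : ∀ ω ∈ T.offFacet F,
      (‖T.weightProj ω ((T.W : H →ₗ[ℂ] H) Φ)‖ / √(ω S - γ S)) ^ 2 =
      ‖T.weightProj ω ((T.W : H →ₗ[ℂ] H) Φ)‖ ^ 2 / (ω S - γ S) := fun ω hω => by
    rw [div_pow, Real.sq_sqrt (hpos ω hω).le]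
  have e3 : ∀ ω ∈ T.offFacet F, √(ω S - γ S) * ‖T.weightProj ω b‖ *
      (‖T.weightProj ω ((T.W : H →ₗ[ℂ] H) Φ)‖ / √(ω S - γ S)) =
      ‖T.weightProj ω b‖ * ‖T.weightProj ω ((T.W : H →ₗ[ℂ] H) Φ)‖ := fun ω hω => by
    have := (Real.sqrt_pos.2 (hpos ω hω)).ne'
    field_simp
  rw [Finset.sum_congr rfl e1, Finset.sum_congr rfl e2, Finset.sum_congr rfl e3] at h1
  refine (neg_le_neg h1).trans ?_
  rw [inner_eq_sum_offFacet hT hb, Complex.re_sum, ← Finset.sum_neg_distrib]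
  refine Finset.sum_le_sum fun ω _ => ?_
  exact (abs_le.1 ((Complex.abs_re_le_norm _).trans (norm_inner_le_norm _ _))).1

/-- A state near `Φ` with density `ρ + ε η` has weight of order `ε` off the facet. Its component in
the facet space can be corrected to a state of density `ρ`, which changes it to order `ε` only,
so that to order `√ε` its energy is that of a state of density `ρ` plus the coupling across the
facet. -/
theorem exists_le_energy (hT : T.IsAbelian) {S : V} {γ η ρ : Module.Dual ℝ V} {Φ : H}
    (hpos : ∀ ω ∈ T.offFacet F, 0 < ω S - γ S) (hSF : ∀ σ ∈ F, σ S = γ S) (hρF : ρ ∈ F)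
    (hηS : η S = 1) (habs : T.CanAbsorb F S γ η Φ) :
    ∃ K r : ℝ, 0 ≤ K ∧ 0 < r ∧ ∀ ε : ℝ, 0 < ε → ε < r → ∀ x : H, ‖x‖ = 1 →
      T.densityMap (ketBra x) = ρ + ε • η → ‖x - Φ‖ < r →
        T.pureFunctional ρ - 2 * √ε * T.repulsion F S γ Φ - K * √ε * (‖x - Φ‖ + √ε) ≤
          ketBra x T.W := by
  classical
  obtain ⟨C, r, hC, hr, hcor⟩ := exists_density_correction hT Φ (T.offFacet F) _ habs
  obtain ⟨M, hM, hW⟩ := exists_abs_re_inner_le T.W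
  set D := ∑ ω ∈ T.offFacet F, (ω S - γ S)⁻¹ with hD
  have hD0 : 0 ≤ D := Finset.sum_nonneg fun ω hω => inv_nonneg.2 (hpos ω hω).le
  set L := C * D + √D with hL
  have hL0 : 0 ≤ L := by positivity
  obtain ⟨r', hr', hr'0⟩ : ∃ r' : ℝ, (r' * D < r ∧ √r' * √D < r / 2 ∧ r' < r / 2 ∧ r' < 1) ∧
      0 < r' := by
    have l1 : Tendsto (fun t : ℝ => t * D) (𝓝[>] 0) (𝓝 (0 * D)) :=
      (continuous_id.mul continuous_const).continuousWithinAt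
    have l2 : Tendsto (fun t : ℝ => √t * √D) (𝓝[>] 0) (𝓝 (√0 * √D)) :=
      (Real.continuous_sqrt.mul continuous_const).continuousWithinAt
    have l3 : Tendsto (fun t : ℝ => t) (𝓝[>] 0) (𝓝 0) := tendsto_id.mono_left nhdsWithin_le_nhds
    rw [zero_mul] at l1
    rw [Real.sqrt_zero, zero_mul] at l2
    exact (((l1.eventually (gt_mem_nhds hr)).and ((l2.eventually (gt_mem_nhds (half_pos hr))).and
      ((l3.eventually (gt_mem_nhds (half_pos hr))).and (l3.eventually (gt_mem_nhds one_pos))))).and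
      self_mem_nhdsWithin).exists
  obtain ⟨hr1, hr2, hr3, hr4⟩ := hr'
  refine ⟨2 * (M * (C * D)) + 2 * (M * √D) + 2 * (M * √D * L) + M * L ^ 2, r', by positivity,
    hr'0, fun ε hε hεr x hx hxρ hxΦ => ?_⟩
  set δ := √ε with hδ
  have hδ0 : 0 ≤ δ := Real.sqrt_nonneg _
  have hδsq : δ ^ 2 = ε := Real.sq_sqrt hε.le
  have hδ1 : δ ≤ 1 := Real.sqrt_le_one.2 (hεr.trans hr4).le
  have hεδ : ε ≤ δ := by rw [← hδsq, sq]; exact mul_le_of_le_one_left hδ0 hδ1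
  -- Evaluating the density on `S` fixes the total weight off the facet.
  have hsum : ∑ ω ∈ T.offFacet F, (ω S - γ S) * ‖T.weightProj ω x‖ ^ 2 = ε := by
    have h1 := densityMap_ketBra_apply hT x S
    rw [hxρ, LinearMap.add_apply, LinearMap.smul_apply, hηS, smul_eq_mul, mul_one, hSF ρ hρF] at h1
    have h2 := norm_sq_eq_sum hT x
    rw [hx, one_pow] at h2
    have h3 : ∑ ω ∈ T.weightFinset, (ω S - γ S) * ‖T.weightProj ω x‖ ^ 2 = ε := by
      simp_rw [sub_mul, Finset.sum_sub_distrib, ← Finset.mul_sum, ← h2]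
      rw [Finset.sum_congr rfl fun ω _ => mul_comm (ω S) _, ← h1]; ring
    rw [← h3]
    refine Finset.sum_subset offFacet_subset fun ω hω h => ?_
    have : ω ∈ F := by
      by_contra hωF; exact h (mem_offFacet.2 ⟨T.mem_weightFinset.1 hω, hωF⟩)
    rw [hSF ω this, sub_self, zero_mul]
  have hq : ∀ ω ∈ T.offFacet F, ‖T.weightProj ω x‖ ^ 2 ≤ ε * (ω S - γ S)⁻¹ := fun ω hω => by
    rw [← div_eq_mul_inv, le_div_iff₀ (hpos ω hω), mul_comm, ← hsum]
    exact Finset.single_le_sum (f := fun ω => (ω S - γ S) * ‖T.weightProj ω x‖ ^ 2)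
      (fun ω hω => mul_nonneg (hpos ω hω).le (sq_nonneg _)) hω
  set b := ∑ ω ∈ T.offFacet F, T.weightProj ω x with hb
  have hbproj : ∀ ω, T.weightProj ω b = if ω ∈ T.offFacet F then T.weightProj ω x else 0 :=
    fun ω => T.weightProj_sum _ (fun ω => T.weightProj ω x) (fun ω => T.weightProj_mem _ _) ω
  have hbF : Disjoint (T.weightSupport b) F := Set.disjoint_left.2 fun ω hω hωF => hω (by
    rw [hbproj, if_neg fun h => (mem_offFacet.1 h).2 hωF])
  have hbx : ∀ ω ∈ T.offFacet F, T.weightProj ω b = T.weightProj ω x := fun ω hω => by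
    rw [hbproj, if_pos hω]
  have hbsq : ‖b‖ ^ 2 = ∑ ω ∈ T.offFacet F, ‖T.weightProj ω x‖ ^ 2 := by
    rw [norm_sq_eq_sum_offFacet hT hbF]
    exact Finset.sum_congr rfl fun ω hω => by rw [hbx ω hω]
  have hbD : ‖b‖ ≤ δ * √D := by
    rw [hδ, ← Real.sqrt_mul hε.le]
    refine Real.le_sqrt_of_sq_le ?_
    rw [hbsq, hD, Finset.mul_sum]
    exact Finset.sum_le_sum hq
  have hdisj : ∀ ω ∈ T.weights, T.weightProj ω (x - b) = 0 ∨ T.weightProj ω b = 0 := fun ω _ => by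
    rw [map_sub, hbproj]
    split_ifs
    · left; exact sub_self _
    · right; rfl
  have hxb : x - b + b = x := sub_add_cancel _ _
  have hbr : ‖b‖ < r / 2 := hbD.trans_lt ((mul_le_mul_of_nonneg_right
    (Real.sqrt_le_sqrt hεr.le) (Real.sqrt_nonneg _)).trans_lt hr2)
  obtain ⟨x', hx', hn, hd⟩ := hcor (x - b) (by
      have : x - b - Φ = (x - Φ) - b := by abel
      rw [this]
      exact (norm_sub_le _ _).trans_lt (by linarith))
    (ε * D) (by positivity) ((mul_le_mul_of_nonneg_right hεr.le hD0).trans_lt hr1)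
    (fun ω => ‖T.weightProj ω x‖ ^ 2) (fun ω hω => by
      rw [abs_of_nonneg (sq_nonneg _)]
      exact (hq ω hω).trans (mul_le_mul_of_nonneg_left (Finset.single_le_sum
        (f := fun ω => (ω S - γ S)⁻¹) (fun ω hω => inv_nonneg.2 (hpos ω hω).le) hω) hε.le))
  have hx'1 : ‖x'‖ = 1 := by
    have h1 := norm_sq_add_of_disjoint hT hdisj
    rw [hxb, hx] at h1
    have : ‖x'‖ ^ 2 = 1 := by rw [hn, ← hbsq]; linarith
    nlinarith [norm_nonneg x']
  have hx'ρ : T.densityMap (ketBra x') = ρ := by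
    have h1 := densityMap_ketBra_add_of_disjoint hT hdisj
    rw [hxb, hxρ, densityMap_ketBra_offFacet hT hbF,
      Finset.sum_congr rfl fun ω hω => by rw [hbx ω hω]] at h1
    have h2 : ∑ ω ∈ T.offFacet F, ‖T.weightProj ω x‖ ^ 2 • (ω - (ω S - γ S) • η) =
        ∑ ω ∈ T.offFacet F, ‖T.weightProj ω x‖ ^ 2 • ω - ε • η := by
      rw [← hsum, Finset.sum_smul, ← Finset.sum_sub_distrib]
      exact Finset.sum_congr rfl fun ω _ => by module
    rw [hd, h2, ← add_sub_assoc, ← h1, add_sub_cancel_right]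
  have hE' := pureFunctional_le hx'1 hx'ρ
  set w := x - x' with hw
  have hwz : w = b - (x' - (x - b)) := by rw [hw]; abel
  have hzn : ‖x' - (x - b)‖ ≤ C * D * ε := hx'.trans (le_of_eq (by ring))
  have hwn : ‖w‖ ≤ L * δ := by
    rw [hwz]
    refine (norm_sub_le _ _).trans ?_
    have := mul_le_mul_of_nonneg_left hεδ (mul_nonneg hC hD0)
    rw [hL]; linarith
  have hE := ketBra_add T.W x' w
  have hx'w : x' + w = x := by rw [hw]; abel
  have hin : (⟪w, (T.W : H →ₗ[ℂ] H) x'⟫_ℂ).re = (⟪b, (T.W : H →ₗ[ℂ] H) Φ⟫_ℂ).re +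
      (⟪b, (T.W : H →ₗ[ℂ] H) (x' - Φ)⟫_ℂ).re -
        (⟪x' - (x - b), (T.W : H →ₗ[ℂ] H) x'⟫_ℂ).re := by
    rw [hwz, inner_sub_left, Complex.sub_re, ← Complex.add_re, ← inner_add_right, ← map_add,
      add_sub_cancel]
  rw [hx'w, hin] at hE
  have i1 := neg_sqrt_mul_repulsion_le hT hpos hbF Φ
  rw [Finset.sum_congr rfl fun ω hω => by rw [hbx ω hω], hsum, ← hδ] at i1
  have hx'Φ : ‖x' - Φ‖ ≤ ‖x - Φ‖ + L * δ := by
    have : x' - Φ = (x - Φ) - w := by rw [hw]; abel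
    rw [this]
    exact (norm_sub_le _ _).trans (by linarith)
  have i2 := (abs_le.1 (hW b (x' - Φ))).1
  have j2 : M * (‖b‖ * ‖x' - Φ‖) ≤ M * (δ * √D * (‖x - Φ‖ + L * δ)) :=
    mul_le_mul_of_nonneg_left (mul_le_mul hbD hx'Φ (norm_nonneg _) (by positivity)) hM
  have i3 := (abs_le.1 (hW (x' - (x - b)) x')).2
  rw [hx'1, mul_one] at i3
  have j3 := mul_le_mul_of_nonneg_left hzn hM
  have i4 : -(M * (‖w‖ * ‖w‖)) ≤ ketBra w T.W := (abs_le.1 (hW w w)).1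
  have j4 := mul_le_mul_of_nonneg_left (mul_self_le_mul_self (norm_nonneg _) hwn) hM
  have hn0 := norm_nonneg (x - Φ)
  have k1 : 0 ≤ (2 * (M * (C * D)) + 2 * (M * √D * L) + M * L ^ 2) * δ * ‖x - Φ‖ := by positivity
  have k2 : 0 ≤ 2 * (M * √D) * δ * δ := by positivity
  rw [hE]
  rw [← hδsq] at j3
  linarith

/-! ### The boundary force formula -/

/-- At a regular value every state can absorb the shift of the density. -/
theorem canAbsorb_of_isRegularValue [FiniteDimensional ℝ V] (hT : T.IsAbelian)
    (hF : IsFacet (convexHull ℝ T.weights) F)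
    {ρ η γ : Module.Dual ℝ V} {S : V} (hρ : ρ ∈ F) (hreg : (T.facetTheory F).IsRegularValue ρ)
    (hη : η ∈ vectorSpan ℝ (convexHull ℝ T.weights)) (hS : ∀ α ∈ vectorSpan ℝ F, α S = 0)
    (hηS : η S = 1) (hγ : γ ∈ affineSpan ℝ F) {Φ : H} (hΦ : ‖Φ‖ = 1)
    (hΦρ : T.densityMap (ketBra Φ) = ρ) : T.CanAbsorb F S γ η Φ := by
  intro ω hω
  obtain ⟨c, hc, h0, h1⟩ := exists_sum_smul_eq_of_mem_vectorSpan (t := T.weightFinset)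
    (by rw [coe_weightFinset]; exact weightSupport_subset _)
    ((facetTheory_isRegularValue_iff hT hF hρ).1 hreg Φ hΦ hΦρ
      (hF.sub_smul_sub_mem_vectorSpan hρ hη hS hηS hγ
        (subset_convexHull ℝ _ (mem_offFacet.1 hω).1)))
  refine ⟨fun τ => c τ + ‖T.weightProj τ Φ‖ ^ 2, fun τ hτ => ?_, ?_, ?_⟩
  · simp [hc τ hτ, weightProj_eq_zero hτ]
  · rw [Finset.sum_add_distrib, h0, ← norm_sq_eq_sum hT, hΦ]; norm_num
  · simp_rw [add_smul, Finset.sum_add_distrib]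
    rw [h1, ← densityMap_ketBra hT, hΦρ, sub_add_cancel]

theorem offFacet_nonempty {η : Module.Dual ℝ V} {S : V}
    (hη : η ∈ vectorSpan ℝ (convexHull ℝ T.weights)) (hS : ∀ α ∈ vectorSpan ℝ F, α S = 0)
    (hηS : η S = 1) : (T.offFacet F).Nonempty := by
  by_contra h
  have hsub : T.weights ⊆ F := fun ω hω => by
    by_contra hωF
    exact h ⟨ω, mem_offFacet.2 ⟨hω, hωF⟩⟩
  rw [← direction_affineSpan, affineSpan_convexHull, direction_affineSpan] at hη
  have := hS η (vectorSpan_mono ℝ hsub hη)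
  exact one_ne_zero (hηS.symm.trans this)

theorem tendsto_boundaryForce [FiniteDimensional ℝ V] (hT : T.IsAbelian)
    (hF : IsFacet (convexHull ℝ T.weights) F)
    {ρ η γ : Module.Dual ℝ V} {S : V} (hρ : ρ ∈ F) (hreg : (T.facetTheory F).IsRegularValue ρ)
    (hη : IsInwardPointing (convexHull ℝ T.weights) F ρ η) (hS : ∀ α ∈ vectorSpan ℝ F, α S = 0)
    (hηS : η S = 1) (hγ : γ ∈ affineSpan ℝ F) {Φ : H} (hΦ : T.IsMinimizer ρ Φ)
    (hbest : ∀ Φ' : H, T.IsMinimizer ρ Φ' →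
      T.boundaryForce F S γ Φ ≤ T.boundaryForce F S γ Φ') :
    Tendsto (fun ε : ℝ => (T.pureFunctional (ρ + ε • η) - T.pureFunctional ρ) / √ε)
      (𝓝[>] 0) (𝓝 (T.boundaryForce F S γ Φ)) := by
  have hpos : ∀ ω ∈ T.offFacet F, 0 < ω S - γ S := fun ω hω =>
    hF.apply_sub_apply_pos hρ hη hS hηS hγ (subset_convexHull ℝ _ (mem_offFacet.1 hω).1)
      (mem_offFacet.1 hω).2
  have hSF : ∀ σ ∈ F, σ S = γ S := fun σ hσ => (apply_eq_of_mem_affineSpan hS hσ hγ).symm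
  obtain ⟨hΦ1, hΦρ, hΦE⟩ := isMinimizer_iff.1 hΦ
  have hsqrt : Tendsto (fun ε : ℝ => √ε) (𝓝[>] 0) (𝓝 0) := by
    have := Real.continuous_sqrt.continuousWithinAt (s := Set.Ioi 0) (x := (0 : ℝ))
    rwa [ContinuousWithinAt, Real.sqrt_zero] at this
  have hid : Tendsto (fun ε : ℝ => ε) (𝓝[>] 0) (𝓝 0) := tendsto_id.mono_left nhdsWithin_le_nhds
  rw [boundaryForce_eq]
  set g := T.repulsion F S γ Φ with hg
  obtain ⟨χ, hχF, hχ1, hχW⟩ := exists_optimal_admixture hT hpos (offFacet_nonempty hη.1 hS hηS) Φ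
  obtain ⟨K, hK⟩ := exists_state_energy_le hT hΦ1 hΦρ
    (weightSupport_subset_facet hT hF hΦ1 (hΦρ ▸ hρ))
    (canAbsorb_of_isRegularValue hT hF hρ hreg hη.1 hS hηS hγ hΦ1 hΦρ) hχF hχ1
  have hupper : ∀ᶠ ε : ℝ in 𝓝[>] 0,
      T.pureFunctional (ρ + ε • η) ≤ T.pureFunctional ρ - 2 * √ε * g + K * ε := by
    filter_upwards [hK] with ε ⟨x, hx, hxρ, hxE⟩
    have := pureFunctional_le hx hxρ
    rw [hχW, ← hg] at hxE
    linarith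
  refine tendsto_order.2 ⟨fun a ha => ?_, fun a ha => ?_⟩
  · -- Minimizers at `ρ + ε η` accumulate at minimizers at `ρ`, where the lower bound applies.
    have hex : ∀ ε : ℝ, ∃ x : H, ρ + ε • η ∈ convexHull ℝ T.weights → ‖x‖ = 1 ∧
        T.densityMap (ketBra x) = ρ + ε • η ∧ ketBra x T.W = T.pureFunctional (ρ + ε • η) := by
      intro ε
      by_cases h : ρ + ε • η ∈ convexHull ℝ T.weights
      · obtain ⟨x, hx⟩ := exists_ketBra_eq_pureFunctional hT h
        exact ⟨x, fun _ => hx⟩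
      · exact ⟨0, fun h' => absurd h' h⟩
    choose Ψ hΨ using hex
    have hΨ' : ∀ᶠ ε : ℝ in 𝓝[>] 0, ‖Ψ ε‖ = 1 ∧ T.densityMap (ketBra (Ψ ε)) = ρ + ε • η ∧
        ketBra (Ψ ε) T.W = T.pureFunctional (ρ + ε • η) :=
      hη.2.mono fun ε hε => hΨ ε hε.1
    refine mem_iff_ultrafilter.2 fun U hU => ?_
    have : ProperSpace H := FiniteDimensional.proper ℂ H
    obtain ⟨Φ₀, hΦ₀, hlim⟩ := (isCompact_sphere (0 : H) 1).ultrafilter_le_nhds (U.map Ψ) (by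
      rw [le_principal_iff]
      exact (hΨ'.filter_mono hU).mono fun ε hε => mem_sphere_zero_iff_norm.2 hε.1)
    have hlim' : Tendsto Ψ U (𝓝 Φ₀) := hlim
    have hΦ₀1 : ‖Φ₀‖ = 1 := mem_sphere_zero_iff_norm.1 hΦ₀
    have hΦ₀ρ : T.densityMap (ketBra Φ₀) = ρ := by
      ext v
      have l1 : Tendsto (fun ε => T.densityMap (ketBra (Ψ ε)) v) U
          (𝓝 (T.densityMap (ketBra Φ₀) v)) :=
        ((continuous_ketBra (T.ι v)).tendsto Φ₀).comp hlim'
      have l2 : Tendsto (fun ε : ℝ => ρ v + ε * η v) U (𝓝 (ρ v + 0 * η v)) :=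
        tendsto_const_nhds.add ((hid.mono_left hU).mul tendsto_const_nhds)
      rw [zero_mul, add_zero] at l2
      refine tendsto_nhds_unique (l1.congr' ?_) l2
      filter_upwards [hΨ'.filter_mono hU] with ε hε
      rw [hε.2.1]; rfl
    have hΦ₀min : T.IsMinimizer ρ Φ₀ := by
      refine isMinimizer_iff.2 ⟨hΦ₀1, hΦ₀ρ, ?_⟩
      have l1 : Tendsto (fun ε => ketBra (Ψ ε) T.W) U (𝓝 (ketBra Φ₀ T.W)) :=
        ((continuous_ketBra T.W).tendsto Φ₀).comp hlim'
      have l2 : Tendsto (fun ε : ℝ => T.pureFunctional ρ - 2 * √ε * g + K * ε) U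
          (𝓝 (T.pureFunctional ρ - 2 * 0 * g + K * 0)) :=
        (tendsto_const_nhds.sub (((hsqrt.mono_left hU).const_mul 2).mul_const g)).add
          ((hid.mono_left hU).const_mul K)
      rw [mul_zero, zero_mul, mul_zero, sub_zero, add_zero] at l2
      refine le_of_tendsto_of_tendsto l1 l2 ?_
      filter_upwards [hΨ'.filter_mono hU, hupper.filter_mono hU] with ε hε hε'
      rw [hε.2.2]; exact hε'
    have hg₀ : T.repulsion F S γ Φ₀ ≤ g := by
      have := hbest Φ₀ hΦ₀min
      rw [boundaryForce_eq, boundaryForce_eq] at this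
      linarith
    obtain ⟨K', r, hK', hr, hlow⟩ := exists_le_energy hT hpos hSF hρ hηS
      (canAbsorb_of_isRegularValue hT hF hρ hreg hη.1 hS hηS hγ hΦ₀1 hΦ₀ρ)
    have hnorm : Tendsto (fun ε => ‖Ψ ε - Φ₀‖) U (𝓝 0) :=
      tendsto_iff_norm_sub_tendsto_zero.1 hlim'
    have l3 : Tendsto (fun ε : ℝ => -2 * g - K' * (‖Ψ ε - Φ₀‖ + √ε)) U
        (𝓝 (-2 * g - K' * (0 + 0))) :=
      tendsto_const_nhds.sub ((hnorm.add (hsqrt.mono_left hU)).const_mul K')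
    rw [add_zero, mul_zero, sub_zero] at l3
    have hev : ∀ᶠ ε in (U : Filter ℝ),
        a < (T.pureFunctional (ρ + ε • η) - T.pureFunctional ρ) / √ε := by
      filter_upwards [hΨ'.filter_mono hU, hU self_mem_nhdsWithin,
        (hid.mono_left hU).eventually (gt_mem_nhds hr), hnorm.eventually (gt_mem_nhds hr),
        l3.eventually (lt_mem_nhds ha)] with ε ⟨h1, h2, h3⟩ hε hεr hεn hεa
      have hε0 : (0 : ℝ) < ε := hε
      have hs := Real.sqrt_pos.2 hε0
      have := hlow ε hε0 hεr (Ψ ε) h1 h2 hεn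
      rw [h3] at this
      rw [lt_div_iff₀ hs]
      have h4 := mul_lt_mul_of_pos_right hεa hs
      have h5 := mul_le_mul_of_nonneg_left hg₀ hs.le
      linarith
    exact hev
  · have l1 : Tendsto (fun ε : ℝ => -2 * g + K * √ε) (𝓝[>] 0) (𝓝 (-2 * g + K * 0)) :=
      tendsto_const_nhds.add (hsqrt.const_mul K)
    rw [mul_zero, add_zero] at l1
    filter_upwards [hupper, self_mem_nhdsWithin, l1.eventually (gt_mem_nhds ha)] with ε h1 hε h2
    have hs := Real.sqrt_pos.2 (show (0 : ℝ) < ε from hε)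
    rw [div_lt_iff₀ hs]
    have h3 := mul_lt_mul_of_pos_right h2 hs
    have h4 : √ε * √ε = ε := Real.mul_self_sqrt (le_of_lt hε)
    rw [add_mul, mul_assoc K, h4] at h3
    linarith

end GeneralizedFunctionalTheory

theorem mainTheorem1 {V H : Type*} [AddCommGroup V] [Module ℝ V] [FiniteDimensional ℝ V]
    [NormedAddCommGroup H] [InnerProductSpace ℂ H] [FiniteDimensional ℂ H]
    (T : GeneralizedFunctionalTheory V H) (hT : T.IsAbelian)
    (F : Set (Module.Dual ℝ V)) (hF : IsFacet (convexHull ℝ T.weights) F)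
    (ρ : Module.Dual ℝ V) (hρ : ρ ∈ F) :
    ((T.facetTheory F).IsRegularValue ρ ↔
      ¬ ∃ s : Finset (Module.Dual ℝ V), (s : Set (Module.Dual ℝ V)) ⊆ T.weights ∧
        s.card ≤ Module.finrank ℝ (vectorSpan ℝ F) ∧
        ρ ∈ convexHull ℝ (s : Set (Module.Dual ℝ V))) ∧
    ((T.facetTheory F).IsRegularValue ρ →
      ∀ (η : Module.Dual ℝ V) (S : V) (γ : Module.Dual ℝ V),
        IsInwardPointing (convexHull ℝ T.weights) F ρ η →
        (∀ α ∈ vectorSpan ℝ F, α S = 0) → η S = 1 → γ ∈ affineSpan ℝ F →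
        (∀ ω ∈ T.weights \ F, 0 < ω S - γ S) ∧
        (∃ Φ : H, T.IsMinimizer ρ Φ ∧
          ∀ Φ' : H, T.IsMinimizer ρ Φ' →
            T.boundaryForce F S γ Φ ≤ T.boundaryForce F S γ Φ') ∧
        ∀ Φ : H, T.IsMinimizer ρ Φ →
          (∀ Φ' : H, T.IsMinimizer ρ Φ' →
            T.boundaryForce F S γ Φ ≤ T.boundaryForce F S γ Φ') →
          Tendsto (fun ε : ℝ =>
              (T.pureFunctional (ρ + ε • η) - T.pureFunctional ρ) / √ε)
            (𝓝[>] 0) (𝓝 (T.boundaryForce F S γ Φ))) := by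
  refine ⟨GeneralizedFunctionalTheory.facetTheory_isRegularValue_iff_not_mem_convexHull hT hF hρ,
    fun hreg η S γ hη hS hηS hγ => ⟨fun ω hω => ?_, ?_, fun Φ hΦ hbest => ?_⟩⟩
  · exact hF.apply_sub_apply_pos hρ hη hS hηS hγ (subset_convexHull ℝ _ hω.1) hω.2
  · exact GeneralizedFunctionalTheory.exists_isMinimizer_boundaryForce_le hT (hF.subset hρ) S γ
  · exact GeneralizedFunctionalTheory.tendsto_boundaryForce hT hF hρ hreg hη hS hηS hγ hΦ hbest
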